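/- Conventions. For a non-constant rational map $f$ let $S_f=\frac{f'''}{f'}-\frac32\left(\frac{f''}{f'}\right)^2$ be its Schwarzian derivative, a meromorphic function on $\mathbb C$. The local degree of $f$ at a point $c\in\widehat{\mathbb C}=\mathbb C\cup\{\infty\}$ is the multiplicity with which $f$ takes the value $f(c)$ at $c$; a critical point is a point of local degree at least $2$. The local coordinate at $c$ is $w=z-c$ if $c\in\mathbb C$, and $w=1/z$ if $c=\infty$. A meromorphic quadratic differential $\phi(z)\,dz^2$ on $\widehat{\mathbb C}$ is given by a function $\phi$ meromorphic on $\mathbb C$ for which $w^{-4}\phi(1/w)$ is meromorphic at $w=0$. Its coefficient at $c$ is $\phi_c(w)=\phi(c+w)$ if $c\in\mathbb C$ and $\phi_\infty(w)=w^{-4}\phi(1/w)$; poles and their orders at $c$ are those of $\phi_c$ at $w=0$. For an integer $d\ge1$ let $M_d(x_1,\dots,x_d)$ be the $d\times d$ matrix with entries $x_{i-j+1}$ for $1\le j\le i\le d$, $2i(i-d)$ for $j=i+1$, and $0$ for $j>i+1$. Let $Y_d(x_1,\dots,x_{d-1})$ be the polynomial with $\det M_d=N\,\bigl(x_d-Y_d(x_1,\dots,x_{d-1})\bigr)$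 for a constant $N\ne0$. We say that $\phi(z)\,dz^2$ has the local form of degree $d$ at $c$ if, near $w=0$, $$w^2\phi_c(w)=\frac{1-d^2}{2}+a_1w+a_2w^2+\cdots,\qquad a_d=Y_d(a_1,\dots,a_{d-1}).$$ Theorem. Let $\phi(z)\,dz^2$ be a meromorphic quadratic differential on the Riemann sphere $\widehat{\mathbb C}$. (a) If $\phi=S_f$ for some non-constant rational map $f$, then every pole of $\phi(z)\,dz^2$ (including $\infty$, if it is a pole) has order two, and at each critical point $c\in\widehat{\mathbb C}$ of $f$, of local degree $d_c\ge2$, $\phi(z)\,dz^2$ has the local form of degree $d_c$. (b) Conversely, suppose that at each pole $c\in\widehat{\mathbb C}$ of $\phi(z)\,dz^2$, except possibly one, $\phi(z)\,dz^2$ has the local form of degree $d_c$ for some integer $d_c\ge2$, and that the exceptional pole, if there is one, has order two. Then there is a non-constant rational map $f$ with $S_f=\phi$. Its critical points in $\widehat{\mathbb C}$ are precisely the poles of $\phi(z)\,dz^2$; at every pole $c$, including the exceptional one, $\phi(z)\,dz^2$ has the local form whose degree is the local degree of $f$ at $c$; and at each non-exceptional pole this local degree is the given $d_c$. -/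

import Mathlib

open Filter Topology

noncomputable section

namespace SchwarzianSphere

/-! ### The polynomials `Y_d` -/

/-- The `d × d` matrix whose entry in row `i` and column `j` (counted from `0`) is `x_{i-j+1}` on
and below the diagonal, `2 (i+1) (i+1-d)` just above the diagonal, and `0` elsewhere. -/
def detMatrix (d : ℕ) (x : ℕ → ℂ) : Matrix (Fin d) (Fin d) ℂ := fun i j =>
  if j ≤ i then x ((i : ℕ) - (j : ℕ) + 1)
  else if (j : ℕ) = (i : ℕ) + 1 then 2 * ((i : ℂ) + 1) * ((i : ℂ) + 1 - (d : ℂ))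
  else 0

/-- The coefficient of `x_d` in the determinant of `detMatrix d x`. -/
def detConst (d : ℕ) : ℂ := ∏ j ∈ Finset.range (d - 1), 2 * ((j : ℂ) + 1) * ((d : ℂ) - ((j : ℂ) + 1))

/-- The polynomial function `Y_d (x_1, …, x_{d-1})`, characterised for `d ≥ 1` by
`det (detMatrix d x) = N * (x_d - Y_d (x_1, …, x_{d-1}))` with a constant `N ≠ 0`
(see `detConst_ne_zero` and `det_detMatrix`). -/
def Y (d : ℕ) (x : ℕ → ℂ) : ℂ := -(detMatrix d (Function.update x d 0)).det / detConst d

theorem detConst_ne_zero (d : ℕ) : detConst d ≠ 0 := by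
  unfold detConst
  refine Finset.prod_ne_zero_iff.2 fun j hj => ?_
  rw [Finset.mem_range] at hj
  have h1 : ((j : ℂ) + 1) ≠ 0 := by exact_mod_cast Nat.succ_ne_zero j
  have h2 : ((d : ℂ) - ((j : ℂ) + 1)) ≠ 0 := by
    rw [sub_ne_zero]
    have : d ≠ j + 1 := by omega
    exact_mod_cast this
  exact mul_ne_zero (mul_ne_zero two_ne_zero h1) h2

theorem det_detMatrix (d : ℕ) (hd : 1 ≤ d) (x : ℕ → ℂ) :
    (detMatrix d x).det = detConst d * (x d - Y d x) := by
  obtain ⟨n, rfl⟩ : ∃ n, d = n + 1 := ⟨d - 1, by omega⟩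
  set y := Function.update x (n + 1) 0 with hy
  have hN := detConst_ne_zero (n + 1)
  have hY : detConst (n + 1) * Y (n + 1) x = -(detMatrix (n + 1) y).det := by
    unfold Y
    rw [mul_div_cancel₀ _ hN]
  rw [mul_sub, hY, Matrix.det_succ_column_zero, Matrix.det_succ_column_zero (detMatrix (n + 1) y),
    sub_neg_eq_add, Fin.sum_univ_castSucc, Fin.sum_univ_castSucc]
  have hsub : ∀ i : Fin (n + 1), (detMatrix (n + 1) y).submatrix i.succAbove Fin.succ
      = (detMatrix (n + 1) x).submatrix i.succAbove Fin.succ := by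
    intro i
    ext a b
    simp only [Matrix.submatrix_apply, detMatrix, Fin.val_succ]
    have := (i.succAbove a).isLt
    split_ifs with h1
    · rw [hy, Function.update_of_ne]
      omega
    · rfl
    · rfl
  have hcol : ∀ i : Fin n, detMatrix (n + 1) y i.castSucc 0 = detMatrix (n + 1) x i.castSucc 0 := by
    intro i
    have := i.isLt
    simp only [detMatrix, Fin.zero_le, if_true, Fin.val_castSucc, Fin.val_zero]
    rw [hy, Function.update_of_ne]
    omega
  have hx : detMatrix (n + 1) x (Fin.last n) 0 = x (n + 1) := by simp [detMatrix]
  have hy0 : detMatrix (n + 1) y (Fin.last n) 0 = 0 := by simp [detMatrix, hy]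
  have hdet : ((detMatrix (n + 1) x).submatrix (Fin.last n).succAbove Fin.succ).det
      = ∏ j ∈ Finset.range n, 2 * ((j : ℂ) + 1) * (((j : ℂ) + 1) - ((n + 1 : ℕ) : ℂ)) := by
    rw [Matrix.det_of_isLowerTriangular, Finset.prod_range]
    · refine Finset.prod_congr rfl fun i _ => ?_
      simp [detMatrix, Fin.le_def]
    · intro i j hij
      have hij' : (i : ℕ) < j := hij
      simp only [Matrix.submatrix_apply, detMatrix, Fin.le_def, Fin.val_succ, Fin.succAbove_last,
        Fin.val_castSucc]
      rw [if_neg (by omega), if_neg (by omega)]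
  have hconst : detConst (n + 1)
      = (-1) ^ n * ∏ j ∈ Finset.range n, 2 * ((j : ℂ) + 1) * (((j : ℂ) + 1) - ((n + 1 : ℕ) : ℂ)) := by
    unfold detConst
    rw [← Finset.card_range n, ← Finset.prod_const, Finset.card_range, ← Finset.prod_mul_distrib]
    refine Finset.prod_congr rfl fun j _ => ?_
    ring
  simp only [hsub, hcol, hx, hy0, hdet, hconst, Fin.val_last]
  ring

/-! ### Meromorphic quadratic differentials on the Riemann sphere

The Riemann sphere is `OnePoint ℂ`. Around `c : ℂ` the local coordinate is `w = z - c`, around `∞`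
it is `w = 1 / z`; in both cases the point itself is `w = 0`. -/

/-- The standard local parametrisation `w ↦ z` of the sphere around `p`. -/
def localParam : OnePoint ℂ → ℂ → ℂ
  | OnePoint.some c => fun w => c + w
  | OnePoint.infty => fun w => w⁻¹

/-- The coefficient of `φ(z) dz²` in the local coordinate `w` around `p`. At `∞` one has `z = 1/w`
and `dz² = dw² / w⁴`. -/
def localCoeff (φ : ℂ → ℂ) : OnePoint ℂ → ℂ → ℂ
  | OnePoint.some c => fun w => φ (c + w)
  | OnePoint.infty => fun w => φ w⁻¹ / w ^ 4

/-- `φ(z) dz²` is a meromorphic quadratic differential on the Riemann sphere. As usual for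
meromorphic objects, `φ` matters only up to its values at isolated points. -/
def IsMeromorphicQuadDiff (φ : ℂ → ℂ) : Prop :=
  ∀ p : OnePoint ℂ, MeromorphicAt (localCoeff φ p) 0

/-- The order of `φ(z) dz²` at `p` (negative at poles, `⊤` if `φ` vanishes near `p`). -/
def orderAt (φ : ℂ → ℂ) (p : OnePoint ℂ) : WithTop ℤ := meromorphicOrderAt (localCoeff φ p) 0

/-- `p` is a pole of `φ(z) dz²`. -/
def IsPole (φ : ℂ → ℂ) (p : OnePoint ℂ) : Prop := orderAt φ p < 0

/-- The local expression: in the local coordinate `w` around `p`,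
`w² φ = (1 - d²)/2 + a_1 w + a_2 w² + ⋯` with `a_d = Y_d (a_1, …, a_{d-1})`. -/
def HasLocalForm (φ : ℂ → ℂ) (p : OnePoint ℂ) (d : ℕ) : Prop :=
  ∃ a : ℕ → ℂ,
    (∀ᶠ w in 𝓝[≠] (0 : ℂ), HasSum (fun n => a n * w ^ n) (w ^ 2 * localCoeff φ p w)) ∧
    a 0 = (1 - (d : ℂ) ^ 2) / 2 ∧ a d = Y d a

/-! ### Rational maps and their Schwarzian derivatives -/

/-- The function `ℂ → ℂ` given by a rational function (the value at a pole is irrelevant). -/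
def toFun (f : RatFunc ℂ) (z : ℂ) : ℂ := f.eval (RingHom.id ℂ) z

/-- The local degree at `x` of a meromorphic function, as a map to the sphere: the order of the
pole at a pole, and otherwise the order of vanishing of `g - g(x)`, where `g(x)` is the limit
of `g` at `x`. -/
def meromorphicLocalDegree (g : ℂ → ℂ) (x : ℂ) : ℕ :=
  if meromorphicOrderAt g x < 0 then (meromorphicOrderAt g x).untop₀.natAbs
  else (meromorphicOrderAt (fun z => g z - limUnder (𝓝[≠] x) g) x).untop₀.natAbs

/-- The local degree at `p` of the self-map of the sphere given by a nonconstant `f`. -/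
def localDegree (f : RatFunc ℂ) (p : OnePoint ℂ) : ℕ :=
  meromorphicLocalDegree (fun w => toFun f (localParam p w)) 0

/-- Critical points of a rational map: the points of local degree at least `2`. -/
def IsCriticalPoint (f : RatFunc ℂ) (p : OnePoint ℂ) : Prop := 2 ≤ localDegree f p

/-- The rational function `f` is not constant. -/
def Nonconstant (f : RatFunc ℂ) : Prop := ∀ a : ℂ, f ≠ RatFunc.C a

/-- The Schwarzian derivative, by its formula at points where `g` is holomorphic and `g' ≠ 0`. -/
def schwarzian (g : ℂ → ℂ) (z : ℂ) : ℂ :=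
  iteratedDeriv 3 g z / deriv g z - 3 / 2 * (iteratedDeriv 2 g z / deriv g z) ^ 2

/-- `φ = S_f` as meromorphic functions on `ℂ`, that is, off a closed discrete set. -/
def IsSchwarzianOf (φ : ℂ → ℂ) (f : RatFunc ℂ) : Prop :=
  φ =ᶠ[codiscrete ℂ] schwarzian (toFun f)

end SchwarzianSphere

end

noncomputable section

namespace SchwarzianSphere

local notation "ι" => algebraMap (Polynomial ℂ) (RatFunc ℂ)

/-! ### The derivation on `ℂ(X)` -/

/-! Multiplying φ by a polynomial that clears its finitely many finite poles gives an entire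
function of polynomial growth, so φ agrees with a rational function Φ
(`IsMeromorphicQuadDiff.exists_ratFunc`). The rest is mostly algebra in ℂ(X) with its derivation. A
map with S_f = Φ is a quotient of two independent solutions of y'' + Φ y / 2 = 0, and the
logarithmic derivative g = y'/y of a solution satisfies g' + g² + Φ/2 = 0.

Local theory. Let t be the local parameter. Inserting y = t^((1-d)/2) (1 + c_1 t + ⋯) gives a
recursion in which c_n has the factor 2n(n - d), so the only obstruction sits at n = d. Its
vanishing is det M_d = 0, that is a_d = Y_d (`eq_Y_iff`). In terms of g it says that the Riccati
equation is solvable modulo t^(d-1) with polar part (1-d)/(2t) (`HasRiccati`, `hasLocalForm_iff`).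
This form is easy to carry through Möbius changes of coordinate.

Part (a). If f is a constant plus t^d times a unit, g = -f''/(2f') is an exact solution; at a pole
the same applies to 1/f, which has the same Schwarzian (`hasRiccati_localDegree_aux`).

Part (b). A Möbius map moves the exceptional point to ∞ (`exists_ratSchwarzian_eq_sphere`). The
equation is written as a connection ∇ on pairs (u, v), twisted so that its solutions become regular.
The approximate Riccati solutions define, at every finite point, a lattice that ∇ preserves. At ∞ a
pole of order at most two suffices for ∇ to lower the growth by one. A section of the lattice
vanishing at ∞ is zero, so ∇ is nilpotent on each global section, and a truncated exponential series
in X turns nilpotency into horizontal sections (`mem_span_horizontal`). They span the plane over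
ℂ(X), and the quotient of two independent ones is f (`exists_ratSchwarzian_eq`). No logarithm
condition is imposed at the exceptional pole; its local form follows from part (a) applied to f. -/

theorem algebraMap_ne_zero {p : Polynomial ℂ} (hp : p ≠ 0) : ι p ≠ 0 :=
  RatFunc.algebraMap_ne_zero hp

/-- The derivative of a rational function, by the quotient rule. -/
def ratDerivFun (u : RatFunc ℂ) : RatFunc ℂ :=
  (ι (u.num.derivative) * ι u.denom - ι u.num * ι (u.denom.derivative)) / ι u.denom ^ 2

/-- Differentiating the cross-multiplied identity `u.num * q = p * u.denom` in ℂ[X] shows that the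
quotient rule does not depend on the fraction chosen, so sums and products need not be reduced to
lowest terms. -/
theorem ratDerivFun_div (p q : Polynomial ℂ) (hq : q ≠ 0) :
    ratDerivFun (ι p / ι q) = (ι p.derivative * ι q - ι p * ι q.derivative) / ι q ^ 2 := by
  set u := ι p / ι q with hu
  have hM := RatFunc.denom_ne_zero u
  have hM' := algebraMap_ne_zero hM
  have hq' := algebraMap_ne_zero hq
  have h0 : u.num * q = p * u.denom := by
    apply RatFunc.algebraMap_injective ℂ
    have h := RatFunc.num_div_denom u
    rw [div_eq_iff hM', hu] at h
    rw [map_mul, map_mul, h, ← hu, hu]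
    field_simp
  have h1 := congrArg Polynomial.derivative h0
  rw [Polynomial.derivative_mul, Polynomial.derivative_mul] at h1
  have e0 := congrArg ι h0
  have e1 := congrArg ι h1
  simp only [map_add, map_mul] at e0 e1
  unfold ratDerivFun
  rw [div_eq_div_iff (pow_ne_zero _ hM') (pow_ne_zero _ hq')]
  linear_combination (ι u.denom * ι q) * e1 - (ι u.denom * ι q.derivative + ι u.denom.derivative * ι q) * e0

/-- The derivation `d/dX` on `ℂ(X)`. -/
def ratDeriv : Derivation ℂ (RatFunc ℂ) (RatFunc ℂ) :=
  Derivation.mk'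
    { toFun := ratDerivFun
      map_add' := by
        intro x y
        induction x using RatFunc.induction_on with | _ p q hq
        induction y using RatFunc.induction_on with | _ r s hs
        have hq' := algebraMap_ne_zero hq
        have hs' := algebraMap_ne_zero hs
        have : ι p / ι q + ι r / ι s = ι (p * s + r * q) / ι (q * s) := by
          simp only [map_add, map_mul]; field_simp
        rw [this, ratDerivFun_div _ _ hq, ratDerivFun_div _ _ hs,
          ratDerivFun_div _ _ (mul_ne_zero hq hs)]
        simp only [Polynomial.derivative_mul, map_add, map_mul]
        field_simp
        ring
      map_smul' := by
        intro a x
        induction x using RatFunc.induction_on with | _ p q hq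
        have hq' := algebraMap_ne_zero hq
        have : a • (ι p / ι q) = ι (Polynomial.C a * p) / ι q := by
          rw [RatFunc.smul_eq_C_mul, map_mul, RatFunc.algebraMap_C]; ring
        rw [this, ratDerivFun_div _ _ hq, ratDerivFun_div _ _ hq, RingHom.id_apply,
          RatFunc.smul_eq_C_mul]
        simp only [Polynomial.derivative_C_mul, map_mul, RatFunc.algebraMap_C]
        ring }
    (by
      intro x y
      induction x using RatFunc.induction_on with | _ p q hq
      induction y using RatFunc.induction_on with | _ r s hs
      have hq' := algebraMap_ne_zero hq
      have hs' := algebraMap_ne_zero hs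
      have : ι p / ι q * (ι r / ι s) = ι (p * r) / ι (q * s) := by
        simp only [map_mul]; field_simp
      simp only [LinearMap.coe_mk, AddHom.coe_mk, smul_eq_mul]
      rw [this, ratDerivFun_div _ _ hq, ratDerivFun_div _ _ hs,
        ratDerivFun_div _ _ (mul_ne_zero hq hs)]
      simp only [Polynomial.derivative_mul, map_add, map_mul]
      field_simp
      ring)

local notation "𝐃" => ratDeriv

theorem ratDeriv_div (p q : Polynomial ℂ) (hq : q ≠ 0) :
    𝐃 (ι p / ι q) = (ι p.derivative * ι q - ι p * ι q.derivative) / ι q ^ 2 :=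
  ratDerivFun_div p q hq

theorem ratDeriv_algebraMap (p : Polynomial ℂ) : 𝐃 (ι p) = ι p.derivative := by
  simpa using ratDeriv_div p 1 one_ne_zero

@[simp] theorem ratDeriv_X : 𝐃 RatFunc.X = 1 := by
  simpa using ratDeriv_algebraMap Polynomial.X

@[simp] theorem ratDeriv_C (a : ℂ) : 𝐃 (RatFunc.C a) = 0 := by
  simpa using ratDeriv_algebraMap (Polynomial.C a)

theorem ratDeriv_mul (u v : RatFunc ℂ) : 𝐃 (u * v) = 𝐃 u * v + u * 𝐃 v := by
  rw [Derivation.leibniz, smul_eq_mul, smul_eq_mul]; ring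

theorem ratDeriv_inv (u : RatFunc ℂ) : 𝐃 u⁻¹ = -𝐃 u / u ^ 2 := by
  rw [Derivation.leibniz_inv, smul_eq_mul]; ring

theorem ratDeriv_quot (u v : RatFunc ℂ) (hv : v ≠ 0) : 𝐃 (u / v) = (𝐃 u * v - u * 𝐃 v) / v ^ 2 := by
  rw [div_eq_mul_inv, ratDeriv_mul, ratDeriv_inv]; field_simp; ring

theorem ratDeriv_pow (u : RatFunc ℂ) (n : ℕ) : 𝐃 (u ^ n) = n * u ^ (n - 1) * 𝐃 u := by
  rw [Derivation.leibniz_pow]; simp [mul_assoc]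

theorem ratDeriv_zpow (u : RatFunc ℂ) (hu : u ≠ 0) (n : ℤ) :
    𝐃 (u ^ n) = n * u ^ (n - 1) * 𝐃 u := by
  obtain ⟨k, rfl | rfl⟩ := n.eq_nat_or_neg
  · rcases k with _ | k
    · simp
    · rw [zpow_natCast, ratDeriv_pow]
      congr 2
      rw [← zpow_natCast]; congr 1; push_cast; omega
  · rcases k with _ | k
    · simp
    · rw [zpow_neg, zpow_natCast, ratDeriv_inv, ratDeriv_pow]
      have : u ^ (-((k + 1 : ℕ) : ℤ) - 1) = (u ^ (k + 2))⁻¹ := by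
        rw [← zpow_natCast, ← zpow_neg]; congr 1
      rw [this]
      push_cast
      field_simp
      ring

@[simp] theorem ratDeriv_C_mul (a : ℂ) (u : RatFunc ℂ) : 𝐃 (RatFunc.C a * u) = RatFunc.C a * 𝐃 u := by
  rw [ratDeriv_mul, ratDeriv_C]; ring

/-- Only constants have derivative zero. -/
theorem eq_C_of_ratDeriv_eq_zero {u : RatFunc ℂ} (h : 𝐃 u = 0) : ∃ a, u = RatFunc.C a := by
  have hd := RatFunc.denom_ne_zero u
  have hd' := algebraMap_ne_zero hd
  rw [← RatFunc.num_div_denom u, ratDeriv_div _ _ hd, div_eq_zero_iff,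
    or_iff_left (pow_ne_zero _ hd'), ← map_mul, ← map_mul, ← map_sub,
    map_eq_zero_iff _ (RatFunc.algebraMap_injective ℂ)] at h
  have hc := RatFunc.isCoprime_num_denom u
  -- Numerator and denominator are coprime, so the vanishing quotient rule makes the denominator
  -- divide its own derivative, which has smaller degree.
  have hdvd : u.denom ∣ u.denom.derivative := by
    refine hc.symm.dvd_of_dvd_mul_left ⟨u.num.derivative, ?_⟩
    linear_combination -h
  have hdd : u.denom.derivative = 0 := by
    by_contra hne
    have := Polynomial.degree_le_of_dvd hdvd hne
    exact absurd (Polynomial.degree_derivative_lt hd) (not_lt.2 this)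
  have hnd : u.num.derivative = 0 := by
    rw [hdd, mul_zero, sub_zero] at h
    exact (mul_eq_zero.1 h).resolve_right hd
  refine ⟨u.num.coeff 0 / u.denom.coeff 0, ?_⟩
  conv_lhs => rw [← RatFunc.num_div_denom u, Polynomial.eq_C_of_derivative_eq_zero hnd,
    Polynomial.eq_C_of_derivative_eq_zero hdd]
  rw [RatFunc.algebraMap_C, RatFunc.algebraMap_C, map_div₀]

/-! ### Rational functions regular at a point -/

/-- The rational functions without a pole at `c`. -/
def regularAt (c : ℂ) : Subring (RatFunc ℂ) where
  carrier := {u | ∃ p q : Polynomial ℂ, q.eval c ≠ 0 ∧ u = ι p / ι q}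
  mul_mem' := by
    rintro _ _ ⟨p, q, hq, rfl⟩ ⟨r, s, hs, rfl⟩
    exact ⟨p * r, q * s, by simp [hq, hs], by rw [map_mul, map_mul, div_mul_div_comm]⟩
  one_mem' := ⟨1, 1, by simp, by simp⟩
  zero_mem' := ⟨0, 1, by simp, by simp⟩
  add_mem' := by
    rintro _ _ ⟨p, q, hq, rfl⟩ ⟨r, s, hs, rfl⟩
    refine ⟨p * s + q * r, q * s, by simp [hq, hs], ?_⟩
    have hq' := algebraMap_ne_zero (p := q) (by rintro rfl; simp at hq)
    have hs' := algebraMap_ne_zero (p := s) (by rintro rfl; simp at hs)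
    rw [div_add_div _ _ hq' hs']
    simp only [map_add, map_mul]
  neg_mem' := by
    rintro _ ⟨p, q, hq, rfl⟩
    exact ⟨-p, q, hq, by rw [map_neg]; ring⟩

local notation "𝓞" => regularAt

/-- The local parameter `X - c`. -/
def param (c : ℂ) : RatFunc ℂ := RatFunc.X - RatFunc.C c

theorem param_eq (c : ℂ) : param c = ι (Polynomial.X - Polynomial.C c) := by
  simp [param]

theorem param_ne_zero (c : ℂ) : param c ≠ 0 := by
  rw [param_eq]; exact algebraMap_ne_zero (Polynomial.X_sub_C_ne_zero c)

@[simp] theorem ratDeriv_param (c : ℂ) : 𝐃 (param c) = 1 := by simp [param]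

theorem algebraMap_mem_regularAt (c : ℂ) (p : Polynomial ℂ) : ι p ∈ 𝓞 c := ⟨p, 1, by simp, by simp⟩

theorem C_mem_regularAt (c a : ℂ) : RatFunc.C a ∈ 𝓞 c := by
  rw [← RatFunc.algebraMap_C]; exact algebraMap_mem_regularAt c _

theorem param_mem_regularAt (c b : ℂ) : param b ∈ 𝓞 c := by
  rw [param_eq]; exact algebraMap_mem_regularAt c _

theorem C_mul_mem_regularAt {c : ℂ} (a : ℂ) {u : RatFunc ℂ} (hu : u ∈ 𝓞 c) : RatFunc.C a * u ∈ 𝓞 c :=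
  mul_mem (C_mem_regularAt c a) hu

theorem ratDeriv_mem_regularAt {c : ℂ} {u : RatFunc ℂ} (hu : u ∈ 𝓞 c) : 𝐃 u ∈ 𝓞 c := by
  obtain ⟨p, q, hq, rfl⟩ := hu
  refine ⟨p.derivative * q - p * q.derivative, q ^ 2, by simp [hq], ?_⟩
  rw [ratDeriv_div _ _ (by rintro rfl; simp at hq)]
  simp only [map_sub, map_mul, map_pow]

theorem exists_value {c : ℂ} {u : RatFunc ℂ} (hu : u ∈ 𝓞 c) :
    ∃ a : ℂ, ∃ s ∈ 𝓞 c, u = RatFunc.C a + param c * s := by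
  obtain ⟨p, q, hq, rfl⟩ := hu
  have hq' := algebraMap_ne_zero (p := q) (by rintro rfl; simp at hq)
  set a := p.eval c / q.eval c with ha
  obtain ⟨r, hr⟩ : (Polynomial.X - Polynomial.C c) ∣ p - Polynomial.C a * q := by
    rw [Polynomial.dvd_iff_isRoot, Polynomial.IsRoot.def]
    simp only [Polynomial.eval_sub, Polynomial.eval_mul, Polynomial.eval_C, ha]
    field_simp
    ring
  refine ⟨a, ι r / ι q, ⟨r, q, hq, rfl⟩, ?_⟩
  have := congrArg ι hr
  simp only [map_sub, map_mul, RatFunc.algebraMap_C, RatFunc.algebraMap_X] at this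
  rw [div_eq_iff hq', param, add_mul, mul_assoc, div_mul_cancel₀ _ hq']
  linear_combination this

theorem C_add_mem_inv {c a : ℂ} (ha : a ≠ 0) {s : RatFunc ℂ} (hs : s ∈ 𝓞 c) :
    (RatFunc.C a + param c * s)⁻¹ ∈ 𝓞 c := by
  obtain ⟨p, q, hq, rfl⟩ := hs
  have hq' := algebraMap_ne_zero (p := q) (by rintro rfl; simp at hq)
  refine ⟨q, Polynomial.C a * q + (Polynomial.X - Polynomial.C c) * p, by simp [ha, hq], ?_⟩
  rw [param_eq, map_add, map_mul, map_mul, RatFunc.algebraMap_C, ← inv_div]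
  field_simp

theorem C_add_ne_zero {c a : ℂ} (ha : a ≠ 0) {s : RatFunc ℂ} (hs : s ∈ 𝓞 c) :
    RatFunc.C a + param c * s ≠ 0 := by
  obtain ⟨p, q, hq, rfl⟩ := hs
  have hq' := algebraMap_ne_zero (p := q) (by rintro rfl; simp at hq)
  intro h
  have h2 : Polynomial.C a * q + (Polynomial.X - Polynomial.C c) * p = 0 := by
    apply RatFunc.algebraMap_injective ℂ
    rw [map_zero, map_add, map_mul, map_mul, RatFunc.algebraMap_C, ← param_eq]
    field_simp at h
    linear_combination h
  have := congrArg (Polynomial.eval c) h2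
  simp [ha, hq] at this

/-- Units of the local ring at `c`. -/
def IsUnitAt (c : ℂ) (u : RatFunc ℂ) : Prop := u ≠ 0 ∧ u ∈ 𝓞 c ∧ u⁻¹ ∈ 𝓞 c

theorem IsUnitAt.mul {c : ℂ} {u v : RatFunc ℂ} (hu : IsUnitAt c u) (hv : IsUnitAt c v) :
    IsUnitAt c (u * v) :=
  ⟨mul_ne_zero hu.1 hv.1, mul_mem hu.2.1 hv.2.1, by rw [mul_inv]; exact mul_mem hu.2.2 hv.2.2⟩

theorem IsUnitAt.inv {c : ℂ} {u : RatFunc ℂ} (hu : IsUnitAt c u) : IsUnitAt c u⁻¹ :=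
  ⟨inv_ne_zero hu.1, hu.2.2, by rw [inv_inv]; exact hu.2.1⟩

theorem IsUnitAt.zpow {c : ℂ} {u : RatFunc ℂ} (hu : IsUnitAt c u) (n : ℤ) : IsUnitAt c (u ^ n) := by
  obtain ⟨k, rfl | rfl⟩ := n.eq_nat_or_neg
  · exact ⟨zpow_ne_zero _ hu.1, by simpa using pow_mem hu.2.1 k, by
      simpa using pow_mem hu.2.2 k⟩
  · exact ⟨zpow_ne_zero _ hu.1, by simpa using pow_mem hu.2.2 k, by
      simpa using pow_mem hu.2.1 k⟩

theorem isUnitAt_C_add {c a : ℂ} (ha : a ≠ 0) {s : RatFunc ℂ} (hs : s ∈ 𝓞 c) :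
    IsUnitAt c (RatFunc.C a + param c * s) :=
  ⟨C_add_ne_zero ha hs, add_mem (C_mem_regularAt c a) (mul_mem (param_mem_regularAt c c) hs),
    C_add_mem_inv ha hs⟩

theorem isUnitAt_algebraMap {c : ℂ} {p : Polynomial ℂ} (hp : p.eval c ≠ 0) : IsUnitAt c (ι p) :=
  ⟨algebraMap_ne_zero (by rintro rfl; simp at hp), algebraMap_mem_regularAt c p,
    ⟨1, p, hp, by simp⟩⟩

theorem isUnitAt_param {c b : ℂ} (h : c ≠ b) : IsUnitAt c (param b) := by
  rw [param_eq]
  apply isUnitAt_algebraMap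
  simpa [sub_eq_zero] using h

/-- A denominator of such a representation would be divisible by X - c. This is why the exponent in
`exists_factor` detects regularity. -/
theorem inv_param_not_mem (c : ℂ) : (param c)⁻¹ ∉ 𝓞 c := by
  rintro ⟨p, q, hq, h⟩
  have hq' := algebraMap_ne_zero (p := q) (by rintro rfl; simp at hq)
  have hp := param_ne_zero c
  have h2 : q = (Polynomial.X - Polynomial.C c) * p := by
    apply RatFunc.algebraMap_injective ℂ
    rw [map_mul, ← param_eq]
    field_simp at h
    linear_combination h
  apply hq
  rw [h2]; simp

theorem exists_poly_factor (c : ℂ) {p : Polynomial ℂ} (hp : p ≠ 0) :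
    ∃ n : ℕ, ∃ q : Polynomial ℂ, q.eval c ≠ 0 ∧ ι p = param c ^ n * ι q := by
  obtain ⟨q, hq, hd⟩ := Polynomial.exists_eq_pow_rootMultiplicity_mul_and_not_dvd p hp c
  refine ⟨p.rootMultiplicity c, q, ?_, ?_⟩
  · rwa [Polynomial.dvd_iff_isRoot] at hd
  · conv_lhs => rw [hq]
    rw [map_mul, map_pow, param_eq]

/-- Every nonzero rational function is a power of the local parameter times a unit. -/
theorem exists_factor (c : ℂ) {u : RatFunc ℂ} (hu : u ≠ 0) :
    ∃ n : ℤ, ∃ v, IsUnitAt c v ∧ u = param c ^ n * v := by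
  induction u using RatFunc.induction_on with | _ p q hq
  have hp : p ≠ 0 := by rintro rfl; simp at hu
  obtain ⟨n, r, hr, hpr⟩ := exists_poly_factor c hp
  obtain ⟨m, s, hs, hqs⟩ := exists_poly_factor c hq
  refine ⟨n - m, ι r / ι s, ?_, ?_⟩
  · rw [div_eq_mul_inv]
    exact (isUnitAt_algebraMap hr).mul (isUnitAt_algebraMap hs).inv
  · have := param_ne_zero c
    rw [hpr, hqs, zpow_sub₀ this, zpow_natCast, zpow_natCast, div_mul_div_comm]

theorem zpow_mul_mem_iff {c : ℂ} {v : RatFunc ℂ} (hv : IsUnitAt c v) (n : ℤ) :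
    param c ^ n * v ∈ 𝓞 c ↔ 0 ≤ n := by
  have ht := param_ne_zero c
  constructor
  · intro h
    by_contra hn
    push Not at hn
    apply inv_param_not_mem c
    obtain ⟨k, hk⟩ : ∃ k : ℕ, n = -(k + 1 : ℕ) := ⟨(-n - 1).toNat, by omega⟩
    have : (param c)⁻¹ = param c ^ k * (param c ^ n * v) * v⁻¹ := by
      have := hv.1
      rw [hk, zpow_neg, zpow_natCast]
      field_simp
      ring
    rw [this]
    exact mul_mem (mul_mem (pow_mem (param_mem_regularAt c c) k) h) hv.2.2
  · intro h
    lift n to ℕ using h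
    rw [zpow_natCast]
    exact mul_mem (pow_mem (param_mem_regularAt c c) n) hv.2.1

theorem exists_pow_mul_mem (c : ℂ) (u : RatFunc ℂ) : ∃ n : ℕ, param c ^ n * u ∈ 𝓞 c := by
  by_cases hu : u = 0
  · exact ⟨0, by simp [hu]⟩
  · obtain ⟨n, v, hv, rfl⟩ := exists_factor c hu
    refine ⟨n.natAbs, ?_⟩
    rw [← mul_assoc, ← zpow_natCast, ← zpow_add₀ (param_ne_zero c), zpow_mul_mem_iff hv]
    omega

theorem C_two : RatFunc.C (2 : ℂ) = 2 := map_ofNat RatFunc.C 2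

/-- A unit has a nonzero value. -/
theorem IsUnitAt.exists_value {c : ℂ} {u : RatFunc ℂ} (hu : IsUnitAt c u) :
    ∃ a : ℂ, a ≠ 0 ∧ ∃ s ∈ 𝓞 c, u = RatFunc.C a + param c * s := by
  obtain ⟨a, s, hs, hus⟩ := SchwarzianSphere.exists_value hu.2.1
  refine ⟨a, ?_, s, hs, hus⟩
  rintro rfl
  apply inv_param_not_mem c
  have : (param c)⁻¹ = s * u⁻¹ := by
    have := hu.1
    have := param_ne_zero c
    rw [map_zero, zero_add] at hus
    field_simp
    rw [hus]
  rw [this]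
  exact mul_mem hs hu.2.2

/-! ### Substitution -/

/-- A nonconstant rational function is transcendental over ℂ, so substituting it never kills a
nonzero denominator. -/
theorem aeval_injective {m : RatFunc ℂ} (hm : Nonconstant m) :
    Function.Injective (Polynomial.aeval m : Polynomial ℂ →ₐ[ℂ] RatFunc ℂ) :=
  transcendental_iff_injective.1 (m.transcendental_of_ne_C fun ⟨a, ha⟩ => hm a ha)

/-- Substitution of a nonconstant rational function for the variable. -/
def subst (m : RatFunc ℂ) (hm : Nonconstant m) : RatFunc ℂ →ₐ[ℂ] RatFunc ℂ :=
  RatFunc.liftAlgHom (Polynomial.aeval m)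
    (nonZeroDivisors_le_comap_nonZeroDivisors_of_injective _ (aeval_injective hm))

theorem subst_div {m : RatFunc ℂ} (hm : Nonconstant m) (p q : Polynomial ℂ) :
    subst m hm (ι p / ι q) = Polynomial.aeval m p / Polynomial.aeval m q :=
  RatFunc.liftAlgHom_apply_div _ _ _ _

theorem subst_algebraMap {m : RatFunc ℂ} (hm : Nonconstant m) (p : Polynomial ℂ) :
    subst m hm (ι p) = Polynomial.aeval m p := by
  simpa using subst_div hm p 1

@[simp] theorem subst_X {m : RatFunc ℂ} (hm : Nonconstant m) : subst m hm RatFunc.X = m := by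
  simpa using subst_algebraMap hm Polynomial.X

@[simp] theorem subst_C {m : RatFunc ℂ} (hm : Nonconstant m) (a : ℂ) :
    subst m hm (RatFunc.C a) = RatFunc.C a := by
  simpa using subst_algebraMap hm (Polynomial.C a)

/-- Two algebra endomorphisms of `ℂ(X)` which agree on `X` are equal. -/
theorem ratFunc_algHom_ext {f g : RatFunc ℂ →ₐ[ℂ] RatFunc ℂ} (h : f RatFunc.X = g RatFunc.X) (u) :
    f u = g u := by
  have hp : ∀ p : Polynomial ℂ, f (ι p) = g (ι p) := by
    intro p
    have : ι p = Polynomial.aeval (RatFunc.X : RatFunc ℂ) p := by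
      rw [RatFunc.aeval_X_left_eq_algebraMap]
    rw [this, ← Polynomial.aeval_algHom_apply, ← Polynomial.aeval_algHom_apply, h]
  induction u using RatFunc.induction_on with | _ p q hq
  rw [map_div₀, map_div₀, hp, hp]

theorem subst_subst {m n : RatFunc ℂ} (hm : Nonconstant m) (hn : Nonconstant n)
    (hmn : Nonconstant (subst m hm n)) (u : RatFunc ℂ) :
    subst m hm (subst n hn u) = subst (subst m hm n) hmn u := by
  refine ratFunc_algHom_ext (f := (subst m hm).comp (subst n hn)) ?_ u
  simp

theorem subst_self (u : RatFunc ℂ) (h : Nonconstant RatFunc.X) : subst RatFunc.X h u = u := by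
  refine ratFunc_algHom_ext (f := subst RatFunc.X h) (g := AlgHom.id ℂ _) ?_ u
  simp

theorem Nonconstant.subst {m f : RatFunc ℂ} (hm : Nonconstant m) (hf : Nonconstant f) :
    Nonconstant (subst m hm f) := by
  intro a ha
  rw [← subst_C hm a] at ha
  exact hf a ((SchwarzianSphere.subst m hm).toRingHom.injective ha)

theorem Nonconstant.ratDeriv_ne_zero {f : RatFunc ℂ} (hf : Nonconstant f) : 𝐃 f ≠ 0 := by
  intro h
  obtain ⟨a, ha⟩ := eq_C_of_ratDeriv_eq_zero h
  exact hf a ha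

theorem nonconstant_of_ratDeriv_ne_zero {f : RatFunc ℂ} (hf : 𝐃 f ≠ 0) : Nonconstant f := by
  rintro a rfl
  exact hf (ratDeriv_C a)

theorem ratDeriv_aeval (m : RatFunc ℂ) (p : Polynomial ℂ) :
    𝐃 (Polynomial.aeval m p) = Polynomial.aeval m p.derivative * 𝐃 m := by
  rw [Derivation.map_aeval, smul_eq_mul]

/-- The chain rule. -/
theorem ratDeriv_subst {m : RatFunc ℂ} (hm : Nonconstant m) (u : RatFunc ℂ) :
    𝐃 (subst m hm u) = subst m hm (𝐃 u) * 𝐃 m := by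
  induction u using RatFunc.induction_on with | _ p q hq
  have h : Polynomial.aeval m q ≠ 0 := by
    rw [Ne, map_eq_zero_iff _ (aeval_injective hm)]; exact hq
  rw [subst_div, ratDeriv_quot _ _ h, ratDeriv_div _ _ hq, ratDeriv_aeval, ratDeriv_aeval]
  simp only [map_div₀, map_sub, map_mul, map_pow, subst_algebraMap]
  field_simp

theorem aeval_mem_regularAt {c : ℂ} {m : RatFunc ℂ} (hm : m ∈ 𝓞 c) (p : Polynomial ℂ) :
    Polynomial.aeval m p ∈ 𝓞 c := by
  induction p using Polynomial.induction_on' with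
  | add p q hp hq => rw [map_add]; exact add_mem hp hq
  | monomial n a =>
    rw [Polynomial.aeval_monomial]
    exact mul_mem (C_mem_regularAt c a) (pow_mem hm n)

theorem exists_aeval_eq (b : ℂ) (p : Polynomial ℂ) (m : RatFunc ℂ) :
    ∃ r : Polynomial ℂ, Polynomial.aeval m p
      = RatFunc.C (p.eval b) + (m - RatFunc.C b) * Polynomial.aeval m r := by
  obtain ⟨r, hr⟩ : (Polynomial.X - Polynomial.C b) ∣ p - Polynomial.C (p.eval b) := by
    rw [Polynomial.dvd_iff_isRoot]; simp
  refine ⟨r, ?_⟩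
  have := congrArg (Polynomial.aeval m) hr
  simp only [map_sub, map_mul, Polynomial.aeval_C, Polynomial.aeval_X] at this
  exact eq_add_of_sub_eq' this

/-- Here m sends c to b, so a denominator nonvanishing at b pulls back to an element with the same
nonzero value at c. -/
theorem subst_mem_regularAt {c b : ℂ} {m V : RatFunc ℂ} (hm : Nonconstant m)
    (hV : V ∈ 𝓞 c) (hmV : m = RatFunc.C b + param c * V) {u : RatFunc ℂ} (hu : u ∈ 𝓞 b) :
    subst m hm u ∈ 𝓞 c := by
  have hmc : m ∈ 𝓞 c := by
    rw [hmV]; exact add_mem (C_mem_regularAt c b) (mul_mem (param_mem_regularAt c c) hV)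
  obtain ⟨p, q, hq, rfl⟩ := hu
  obtain ⟨r, hr⟩ := exists_aeval_eq b q m
  rw [subst_div, div_eq_mul_inv]
  refine mul_mem (aeval_mem_regularAt hmc p) ?_
  have : Polynomial.aeval m q = RatFunc.C (q.eval b) + param c * (V * Polynomial.aeval m r) := by
    rw [hr]
    linear_combination (Polynomial.aeval m r) * hmV
  rw [this]
  exact C_add_mem_inv hq (mul_mem hV (aeval_mem_regularAt hmc r))

/-! ### The algebraic Schwarzian derivative -/

/-- The Schwarzian derivative of a rational function as a rational function. -/
def ratSchwarzian (f : RatFunc ℂ) : RatFunc ℂ :=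
  𝐃 (𝐃 (𝐃 f)) / 𝐃 f - 3 / 2 * (𝐃 (𝐃 f) / 𝐃 f) ^ 2

/-- The cocycle identity. For Möbius m the last term vanishes and the Schwarzian transforms as a
quadratic differential. -/
theorem ratSchwarzian_subst {m f : RatFunc ℂ} (hm : Nonconstant m) (hf : Nonconstant f) :
    ratSchwarzian (subst m hm f) = subst m hm (ratSchwarzian f) * 𝐃 m ^ 2 + ratSchwarzian m := by
  have h1 := hm.ratDeriv_ne_zero
  have h2 : subst m hm (𝐃 f) ≠ 0 := by
    exact (map_ne_zero (subst m hm)).2 hf.ratDeriv_ne_zero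
  unfold ratSchwarzian
  simp only [ratDeriv_subst, ratDeriv_mul, map_add, map_sub, map_mul, map_div₀, map_pow, map_ofNat]
  field_simp
  ring

/-- Post-composition with inversion. It reduces poles of f to zeros of 1/f, and yields the vanishing
Schwarzians of the Möbius maps used later. -/
theorem ratSchwarzian_inv {f : RatFunc ℂ} (hf : Nonconstant f) :
    ratSchwarzian f⁻¹ = ratSchwarzian f := by
  have h1 := hf.ratDeriv_ne_zero
  have h2 : f ≠ 0 := by rintro rfl; simp at h1
  have h3 : 𝐃 f⁻¹ = -(𝐃 f * (f⁻¹) ^ 2) := by rw [ratDeriv_inv]; field_simp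
  have h4 : 𝐃 (𝐃 f⁻¹) = -(𝐃 (𝐃 f) * (f⁻¹) ^ 2) + 2 * 𝐃 f ^ 2 * (f⁻¹) ^ 3 := by
    rw [h3, map_neg, ratDeriv_mul, pow_two, ratDeriv_mul, h3]; ring
  have h5 : 𝐃 (𝐃 (𝐃 f⁻¹)) = -(𝐃 (𝐃 (𝐃 f)) * (f⁻¹) ^ 2) + 6 * 𝐃 f * 𝐃 (𝐃 f) * (f⁻¹) ^ 3
      - 6 * 𝐃 f ^ 3 * (f⁻¹) ^ 4 := by
    rw [h4, map_add, map_neg]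
    have : (2 : RatFunc ℂ) = RatFunc.C 2 := C_two.symm
    rw [this]
    simp only [ratDeriv_mul, pow_succ, pow_zero, one_mul, h3, ratDeriv_C]
    rw [← this]
    ring
  unfold ratSchwarzian
  rw [h5, h4, h3]
  field_simp
  ring

theorem ratSchwarzian_C_add (a : ℂ) (f : RatFunc ℂ) :
    ratSchwarzian (RatFunc.C a + f) = ratSchwarzian f := by
  unfold ratSchwarzian
  rw [map_add, ratDeriv_C, zero_add]

/-! ### Approximate solutions of the Riccati equation -/

/-- The Riccati equation `g' + g² + Ψ/2 = 0` has a solution modulo `t ^ (d - 1)`, where `t = X - c`,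
with polar part `(1 - d) / (2 t)`. -/
def HasRiccati (Ψ : RatFunc ℂ) (c : ℂ) (d : ℕ) : Prop :=
  ∃ g : RatFunc ℂ, g + RatFunc.C (((d : ℂ) - 1) / 2) / param c ∈ 𝓞 c ∧
    ∃ s ∈ 𝓞 c, 𝐃 g + g ^ 2 + Ψ / 2 = param c ^ (d - 1) * s

theorem half_mem_regularAt {c : ℂ} {u : RatFunc ℂ} (hu : u ∈ 𝓞 c) : u / 2 ∈ 𝓞 c := by
  have : u / 2 = RatFunc.C (1 / 2) * u := by
    rw [map_div₀, map_one, C_two]; ring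
  rw [this]; exact C_mul_mem_regularAt _ hu

/-- For d = 1 there is no polar part and the modulus is t^0, so the condition only expresses
regularity; the converse is `HasRiccati.regular`. -/
theorem hasRiccati_one {Ψ : RatFunc ℂ} {c : ℂ} (h : Ψ ∈ 𝓞 c) : HasRiccati Ψ c 1 := by
  refine ⟨0, by simp, Ψ / 2, half_mem_regularAt h, by simp⟩

/-- The function y = (G')^(-1/2) solves y'' + S_G y / 2 = 0, and its logarithmic derivative is
-G''/(2G'). -/
theorem riccati_logDeriv {G : RatFunc ℂ} (hG : 𝐃 G ≠ 0) :
    𝐃 (-(𝐃 (𝐃 G) / 𝐃 G / 2)) + (-(𝐃 (𝐃 G) / 𝐃 G / 2)) ^ 2 + ratSchwarzian G / 2 = 0 := by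
  have h2 : (2 : RatFunc ℂ) = RatFunc.C 2 := C_two.symm
  have : 𝐃 (-(𝐃 (𝐃 G) / 𝐃 G / 2))
      = -((𝐃 (𝐃 (𝐃 G)) * 𝐃 G - 𝐃 (𝐃 G) * 𝐃 (𝐃 G)) / 𝐃 G ^ 2 / 2) := by
    rw [map_neg, ratDeriv_quot (𝐃 (𝐃 G) / 𝐃 G) 2 two_ne_zero, ratDeriv_quot _ _ hG, h2, ratDeriv_C,
      ← h2]
    field_simp
    ring
  rw [this]
  unfold ratSchwarzian
  field_simp
  ring

/-- If `G` vanishes to order `d` at `c`, then `-G''/(2G')` solves the Riccati equation. -/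
theorem hasRiccati_ratSchwarzian {c : ℂ} {d : ℕ} (hd : 1 ≤ d) {U : RatFunc ℂ} (hU : IsUnitAt c U) :
    HasRiccati (ratSchwarzian (param c ^ d * U)) c d := by
  have ht := param_ne_zero c
  obtain ⟨a, ha, s, hs, hUs⟩ := hU.exists_value
  -- V is the derivative of t^d U divided by t^(d-1); its value at c is d times that of U.
  set V := d * U + param c * 𝐃 U with hV
  have hVu : IsUnitAt c V := by
    have h : V = RatFunc.C (d * a) + param c * (d * s + 𝐃 U) := by
      rw [hV, hUs, map_mul, map_natCast]; ring
    rw [h]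
    refine isUnitAt_C_add (mul_ne_zero (by exact_mod_cast (by omega : d ≠ 0)) ha) ?_
    exact add_mem (mul_mem (natCast_mem _ _) hs)
      (ratDeriv_mem_regularAt hU.2.1)
  have hDG : 𝐃 (param c ^ d * U) = param c ^ (d - 1) * V := by
    obtain ⟨n, rfl⟩ : ∃ n, d = n + 1 := ⟨d - 1, by omega⟩
    rw [ratDeriv_mul, ratDeriv_pow, ratDeriv_param, hV, Nat.add_sub_cancel]
    ring
  have hDG0 : 𝐃 (param c ^ d * U) ≠ 0 := by
    rw [hDG]; exact mul_ne_zero (pow_ne_zero _ ht) hVu.1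
  refine ⟨_, ?_, 0, zero_mem _, by rw [riccati_logDeriv hDG0, mul_zero]⟩
  have hlog : 𝐃 (𝐃 (param c ^ d * U)) / 𝐃 (param c ^ d * U)
      = RatFunc.C ((d : ℂ) - 1) / param c + 𝐃 V / V := by
    have hV0 := hVu.1
    obtain ⟨n, rfl⟩ : ∃ n, d = n + 1 := ⟨d - 1, by omega⟩
    rw [hDG, ratDeriv_mul, ratDeriv_pow, ratDeriv_param, Nat.add_sub_cancel]
    rcases n with _ | n
    · simp
    · rw [Nat.add_sub_cancel]
      push_cast
      rw [add_sub_cancel_right, map_add RatFunc.C, map_one, map_natCast]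
      field_simp
      ring
  rw [hlog]
  have : -((RatFunc.C ((d : ℂ) - 1) / param c + 𝐃 V / V) / 2)
      + RatFunc.C (((d : ℂ) - 1) / 2) / param c = -(𝐃 V * V⁻¹ / 2) := by
    rw [map_div₀, C_two]
    ring
  rw [this]
  exact neg_mem (half_mem_regularAt (mul_mem (ratDeriv_mem_regularAt hVu.2.1) hVu.2.2))

/-- The Riccati condition is invariant under Möbius changes of coordinate. -/
theorem HasRiccati.subst {Φ : RatFunc ℂ} {b c : ℂ} {d : ℕ} (h : HasRiccati Φ b d)
    {m V : RatFunc ℂ} (hm : Nonconstant m) (hV : IsUnitAt c V)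
    (hmV : m = RatFunc.C b + param c * V) (hS : ratSchwarzian m = 0) :
    HasRiccati (SchwarzianSphere.subst m hm Φ * 𝐃 m ^ 2) c d := by
  obtain ⟨G, hG, s, hs, hGs⟩ := h
  have ht := param_ne_zero c
  have hm' := hm.ratDeriv_ne_zero
  set σ := SchwarzianSphere.subst m hm with hσ
  have hreg : ∀ {u}, u ∈ 𝓞 b → σ u ∈ 𝓞 c := fun hu => subst_mem_regularAt hm hV.2.1 hmV hu
  have hσp : σ (param b) = param c * V := by
    rw [param, map_sub, hσ, subst_X, subst_C, hmV]; ring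
  have hDm : 𝐃 m = V + param c * 𝐃 V := by
    rw [hmV, map_add, ratDeriv_C, ratDeriv_mul, ratDeriv_param]; ring
  obtain ⟨a, ha, r, hr, hVr⟩ := hV.exists_value
  have hDmu : IsUnitAt c (𝐃 m) := by
    have : 𝐃 m = RatFunc.C a + param c * (r + 𝐃 V) := by
      rw [hDm]; linear_combination hVr
    rw [this]
    exact isUnitAt_C_add ha (add_mem hr (ratDeriv_mem_regularAt hV.2.1))
  -- Solutions transform with weight -1/2, as y ↦ (y ∘ m) (m')^(-1/2); the witness is the
  -- logarithmic derivative of the latter.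
  refine ⟨σ G * 𝐃 m - 𝐃 (𝐃 m) / 𝐃 m / 2, ?_, V ^ (d - 1) * σ s * 𝐃 m ^ 2, ?_, ?_⟩
  · have hV0 := hV.1
    have : σ G * 𝐃 m - 𝐃 (𝐃 m) / 𝐃 m / 2 + RatFunc.C (((d : ℂ) - 1) / 2) / param c
        = σ (G + RatFunc.C (((d : ℂ) - 1) / 2) / param b) * 𝐃 m
          - RatFunc.C (((d : ℂ) - 1) / 2) * (𝐃 V * V⁻¹) - 𝐃 (𝐃 m) * (𝐃 m)⁻¹ / 2 := by
      rw [map_add σ, map_div₀ σ, hσp, hσ, subst_C]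
      have : RatFunc.C (((d : ℂ) - 1) / 2) / (param c * V) * 𝐃 m
        = RatFunc.C (((d : ℂ) - 1) / 2) / param c
          + RatFunc.C (((d : ℂ) - 1) / 2) * (𝐃 V * V⁻¹) := by
        rw [hDm]; field_simp
      rw [add_mul, this]
      ring
    rw [this]
    exact sub_mem (sub_mem (mul_mem (hreg hG) hDmu.2.1) (C_mul_mem_regularAt _
      (mul_mem (ratDeriv_mem_regularAt hV.2.1) hV.2.2)))
      (half_mem_regularAt (mul_mem (ratDeriv_mem_regularAt hDmu.2.1) hDmu.2.2))
  · exact mul_mem (mul_mem (pow_mem hV.2.1 _) (hreg hs)) (pow_mem hDmu.2.1 _)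
  · have h0 := riccati_logDeriv hm'
    rw [hS, map_neg] at h0
    have h1 := congrArg σ hGs
    simp only [map_add, map_mul, map_pow, map_div₀, map_ofNat, hσp] at h1
    rw [map_sub, ratDeriv_mul, hσ, ratDeriv_subst, ← hσ]
    have h2 : 𝐃 (𝐃 m) / 𝐃 m * 𝐃 m = 𝐃 (𝐃 m) := div_mul_cancel₀ _ hm'
    linear_combination (𝐃 m) ^ 2 * h1 + h0 - σ G * h2

/-! ### The determinant condition as the solvability of a recursion -/

theorem detMatrix_mulVec (d : ℕ) (a w : ℕ → ℂ) (i : Fin d) :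
    (detMatrix d a).mulVec (fun j => w j) i
      = 2 * ((i : ℕ) + 1 : ℕ) * (((i : ℕ) + 1 : ℕ) - d) * w (i + 1)
        + ∑ k ∈ Finset.range (i + 1), a (i + 1 - k) * w k := by
  have hrow : ∀ j : Fin d, detMatrix d a i j * w j
      = (fun j : ℕ => (if j ∈ Finset.range (i + 1) then a (i + 1 - j) * w j else 0)
        + (if j = i + 1 then
          2 * ((i : ℕ) + 1 : ℕ) * (((i : ℕ) + 1 : ℕ) - (d : ℂ)) * w (i + 1) else 0)) j := by
    intro j
    simp only [detMatrix, Fin.le_def, Finset.mem_range, Nat.lt_succ_iff]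
    by_cases h : (j : ℕ) ≤ i
    · have h2 : ¬ (j : ℕ) = i + 1 := by omega
      simp only [h, h2, if_true, if_false, add_zero]
      congr 2; omega
    · by_cases h2 : (j : ℕ) = i + 1
      · simp only [h2, if_true]
        simp
      · simp [h, h2]
  rw [Matrix.mulVec, dotProduct, Finset.sum_congr rfl fun j _ => hrow j, ← Finset.sum_range
    (f := fun j : ℕ => (if j ∈ Finset.range (i + 1) then a (i + 1 - j) * w j else 0)
        + (if j = i + 1 then
          2 * ((i : ℕ) + 1 : ℕ) * (((i : ℕ) + 1 : ℕ) - (d : ℂ)) * w (i + 1) else 0)),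
    Finset.sum_add_distrib, Finset.sum_ite_mem, Finset.sum_ite_eq', add_comm]
  congr 1
  · split_ifs with h
    · rfl
    -- In the last row the superdiagonal entry would lie outside the matrix, but its formula gives 0
    -- there, so the identity holds for that row too.
    · have : (i : ℕ) + 1 = d := by
        have := i.isLt
        rw [Finset.mem_range] at h; omega
      rw [this]; ring
  · congr 1
    ext k
    have := i.isLt
    simp only [Finset.mem_inter, Finset.mem_range]
    omega

/-- The rows of M_d are the steps n = 1, …, d of the Frobenius recursion. For n < d the factor 2n(n
- d) is nonzero, so a kernel vector is determined by its entry 0, which can be normalised to 1; the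
row n = d is the compatibility condition. -/
theorem det_detMatrix_eq_zero_iff {d : ℕ} (hd : 1 ≤ d) (a : ℕ → ℂ) :
    (detMatrix d a).det = 0 ↔ ∃ c : ℕ → ℂ, c 0 = 1 ∧ ∀ n, 1 ≤ n → n ≤ d →
      2 * n * (n - d) * c n + ∑ k ∈ Finset.range n, a (n - k) * c k = 0 := by
  rw [← Matrix.exists_mulVec_eq_zero_iff]
  constructor
  · rintro ⟨v, hv, hMv⟩
    -- The default value 0 at j = d is harmless: w d only occurs with the factor 2d(d - d).
    set w : ℕ → ℂ := fun j => if h : j < d then v ⟨j, h⟩ else 0 with hw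
    have hwv : (fun j : Fin d => w j) = v := by
      ext j; simp [hw]
    have hrec : ∀ n, 1 ≤ n → n ≤ d →
        2 * n * (n - d) * w n + ∑ k ∈ Finset.range n, a (n - k) * w k = 0 := by
      intro n hn hnd
      obtain ⟨m, rfl⟩ : ∃ m, n = m + 1 := ⟨n - 1, by omega⟩
      have := detMatrix_mulVec d a w ⟨m, by omega⟩
      rw [hwv, hMv] at this
      exact this.symm
    have hw0 : w 0 ≠ 0 := by
      intro h0
      apply hv
      rw [← hwv]
      have : ∀ n, n < d → w n = 0 := by
        intro n
        induction n using Nat.strong_induction_on with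
        | _ n ih =>
          intro hn
          rcases Nat.eq_zero_or_pos n with rfl | hpos
          · exact h0
          · have h := hrec n hpos hn.le
            rw [Finset.sum_eq_zero, add_zero] at h
            · have h1 : (n : ℂ) ≠ 0 := by exact_mod_cast hpos.ne'
              have h2 : (n : ℂ) - d ≠ 0 := by
                rw [sub_ne_zero]; exact_mod_cast hn.ne
              simpa [h1, h2] using h
            · intro k hk
              rw [Finset.mem_range] at hk
              rw [ih k hk (hk.trans hn), mul_zero]
      ext j
      exact this j j.isLt
    refine ⟨fun n => w n / w 0, div_self hw0, fun n hn hnd => ?_⟩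
    have : ∑ k ∈ Finset.range n, a (n - k) * (w k / w 0)
        = (∑ k ∈ Finset.range n, a (n - k) * w k) / w 0 := by
      rw [Finset.sum_div]
      exact Finset.sum_congr rfl fun k _ => by ring
    rw [this]
    have h := hrec n hn hnd
    field_simp
    linear_combination h
  · rintro ⟨c, hc0, hc⟩
    refine ⟨fun j => c j, ?_, ?_⟩
    · intro h
      have := congrFun h ⟨0, hd⟩
      simp [hc0] at this
    · ext i
      rw [detMatrix_mulVec]
      exact hc (i + 1) (by omega) i.isLt

theorem eq_Y_iff {d : ℕ} (hd : 1 ≤ d) (a : ℕ → ℂ) :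
    a d = Y d a ↔ ∃ c : ℕ → ℂ, c 0 = 1 ∧ ∀ n, 1 ≤ n → n ≤ d →
      2 * n * (n - d) * c n + ∑ k ∈ Finset.range n, a (n - k) * c k = 0 := by
  rw [← det_detMatrix_eq_zero_iff hd, det_detMatrix d hd, mul_eq_zero,
    or_iff_right (detConst_ne_zero d), sub_eq_zero]

/-! ### The local form and the Riccati equation -/

/-- The rational function `Ψ` has the expansion `t² Ψ = ∑_{n ≤ d} a_n t ^ n + O(t ^ (d + 1))`. -/
def HasExpansion (Ψ : RatFunc ℂ) (c : ℂ) (d : ℕ) (a : ℕ → ℂ) : Prop :=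
  ∃ s ∈ 𝓞 c, param c ^ 2 * Ψ
    = Polynomial.aeval (param c) (∑ n ∈ Finset.range (d + 1), Polynomial.monomial n (a n))
      + param c ^ (d + 1) * s

theorem coeff_sum_monomial (d : ℕ) (a : ℕ → ℂ) {n : ℕ} (hn : n ≤ d) :
    (∑ n ∈ Finset.range (d + 1), Polynomial.monomial n (a n)).coeff n = a n := by
  rw [Polynomial.finsetSum_coeff]
  simp only [Polynomial.coeff_monomial]
  rw [Finset.sum_ite_eq', if_pos (by simpa using hn)]

/-- The operator `2 X² P'' + 2 (1 - d) X P' + B P`. -/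
def frobenius (d : ℕ) (B P : Polynomial ℂ) : Polynomial ℂ :=
  2 * (Polynomial.X * (Polynomial.X * P.derivative).derivative)
    - 2 * (d : Polynomial ℂ) * (Polynomial.X * P.derivative) + P * B

theorem coeff_X_mul_derivative (P : Polynomial ℂ) (n : ℕ) :
    (Polynomial.X * P.derivative).coeff n = n * P.coeff n := by
  rcases n with _ | n
  · simp
  · rw [Polynomial.coeff_X_mul, Polynomial.coeff_derivative]; push_cast; ring

/-- When B has no constant term this is the left side of the recursion in `eq_Y_iff`. The constant
term a_0 of t²Ψ is removed from B because it is consumed by the indicial equation of the exponent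
(1-d)/2. -/
theorem coeff_frobenius (d : ℕ) (B P : Polynomial ℂ) (n : ℕ) :
    (frobenius d B P).coeff n = (2 * n * (n - d) + B.coeff 0) * P.coeff n
      + ∑ k ∈ Finset.range n, B.coeff (n - k) * P.coeff k := by
  have h1 : (2 * (Polynomial.X * (Polynomial.X * P.derivative).derivative)).coeff n
      = 2 * (n * (n * P.coeff n)) := by
    have : (2 : Polynomial ℂ) = Polynomial.C 2 := (map_ofNat Polynomial.C 2).symm
    rw [this, Polynomial.coeff_C_mul, coeff_X_mul_derivative, coeff_X_mul_derivative]
  have h2 : (2 * (d : Polynomial ℂ) * (Polynomial.X * P.derivative)).coeff n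
      = 2 * d * (n * P.coeff n) := by
    have : 2 * (d : Polynomial ℂ) = Polynomial.C (2 * (d : ℂ)) := by
      rw [map_mul, map_natCast, map_ofNat]
    rw [this, Polynomial.coeff_C_mul, coeff_X_mul_derivative]
  rw [frobenius, Polynomial.coeff_add, Polynomial.coeff_sub, h1, h2, Polynomial.coeff_mul,
    Finset.Nat.sum_antidiagonal_eq_sum_range_succ_mk, Finset.sum_range_succ, Nat.sub_self]
  have : ∑ k ∈ Finset.range n, P.coeff k * B.coeff (n - k)
      = ∑ k ∈ Finset.range n, B.coeff (n - k) * P.coeff k :=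
    Finset.sum_congr rfl fun k _ => mul_comm _ _
  rw [this]
  ring

theorem aeval_frobenius (c : ℂ) (d : ℕ) (B P : Polynomial ℂ) :
    Polynomial.aeval (param c) (frobenius d B P)
      = 2 * param c ^ 2 * 𝐃 (𝐃 (Polynomial.aeval (param c) P))
        + 2 * (1 - d) * param c * 𝐃 (Polynomial.aeval (param c) P)
        + Polynomial.aeval (param c) P * Polynomial.aeval (param c) B := by
  simp only [frobenius, map_add, map_sub, map_mul, map_ofNat, map_natCast, Polynomial.aeval_X,
    ratDeriv_aeval, ratDeriv_param, mul_one, Polynomial.derivative_mul, Polynomial.derivative_X,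
    one_mul]
  ring

theorem aeval_param_eq (c : ℂ) (P : Polynomial ℂ) :
    Polynomial.aeval (param c) P
      = RatFunc.C (P.coeff 0) + param c * Polynomial.aeval (param c) P.divX := by
  conv_lhs => rw [← P.X_mul_divX_add]
  rw [map_add, map_mul, Polynomial.aeval_X, Polynomial.aeval_C, add_comm]
  rfl

theorem aeval_param_mem (c : ℂ) (P : Polynomial ℂ) : Polynomial.aeval (param c) P ∈ 𝓞 c :=
  aeval_mem_regularAt (param_mem_regularAt c c) P

/-- Coefficients below order `N` of a polynomial in `t` divisible by `t ^ N` vanish. -/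
theorem coeff_eq_zero_of_aeval_eq {c : ℂ} (N : ℕ) (P : Polynomial ℂ) {s : RatFunc ℂ} (hs : s ∈ 𝓞 c)
    (h : Polynomial.aeval (param c) P = param c ^ N * s) {n : ℕ} (hn : n < N) : P.coeff n = 0 := by
  induction N generalizing P n with
  | zero => omega
  | succ N ih =>
    have h0 : P.coeff 0 = 0 := by
      by_contra hne
      refine C_add_ne_zero hne (c := c)
        (s := Polynomial.aeval (param c) P.divX - param c ^ N * s)
        (sub_mem (aeval_param_mem c _) (mul_mem (pow_mem (param_mem_regularAt c c) _) hs)) ?_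
      rw [aeval_param_eq] at h
      linear_combination h
    rcases n with _ | n
    · exact h0
    · rw [← Polynomial.coeff_divX]
      refine ih P.divX ?_ (by omega)
      rw [aeval_param_eq, h0, map_zero, zero_add] at h
      apply mul_left_cancel₀ (param_ne_zero c)
      rw [h]; ring

theorem exists_aeval_eq_pow_mul {c : ℂ} {N : ℕ} {P : Polynomial ℂ} (h : ∀ n < N, P.coeff n = 0) :
    ∃ s ∈ 𝓞 c, Polynomial.aeval (param c) P = param c ^ N * s := by
  obtain ⟨Q, rfl⟩ := Polynomial.X_pow_dvd_iff.2 h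
  exact ⟨_, aeval_param_mem c Q, by simp⟩

/-- Truncated Taylor expansion. -/
theorem exists_truncation {c : ℂ} {u : RatFunc ℂ} (hu : u ∈ 𝓞 c) (N : ℕ) :
    ∃ P : Polynomial ℂ, ∃ s ∈ 𝓞 c, u = Polynomial.aeval (param c) P + param c ^ N * s := by
  induction N generalizing u with
  | zero => exact ⟨0, u, hu, by simp⟩
  | succ N ih =>
    obtain ⟨a, s, hs, rfl⟩ := exists_value hu
    obtain ⟨P, r, hr, rfl⟩ := ih hs
    refine ⟨Polynomial.C a + Polynomial.X * P, r, hr, ?_⟩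
    rw [map_add, map_mul, Polynomial.aeval_X, Polynomial.aeval_C]
    have : algebraMap ℂ (RatFunc ℂ) a = RatFunc.C a := rfl
    rw [this]
    ring

theorem exists_hasExpansion {Ψ : RatFunc ℂ} {c : ℂ} (h : param c ^ 2 * Ψ ∈ 𝓞 c) (d : ℕ) :
    ∃ a, HasExpansion Ψ c d a := by
  obtain ⟨P, s, hs, hP⟩ := exists_truncation h (d + 1)
  set A := ∑ n ∈ Finset.range (d + 1), Polynomial.monomial n (P.coeff n) with hA
  obtain ⟨r, hr, hPr⟩ := exists_aeval_eq_pow_mul (c := c) (N := d + 1) (P := P - A) (by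
    intro n hn
    rw [Polynomial.coeff_sub, hA, coeff_sum_monomial _ _ (by omega), sub_self])
  refine ⟨P.coeff, r + s, add_mem hr hs, ?_⟩
  rw [map_sub] at hPr
  rw [hP, ← hA]
  linear_combination hPr

theorem C_half_sub_one (d : ℕ) : RatFunc.C (((d : ℂ) - 1) / 2) = ((d : RatFunc ℂ) - 1) / 2 := by
  rw [map_div₀, map_sub, map_natCast, map_one, C_two]

theorem C_leading (d : ℕ) : RatFunc.C ((1 - (d : ℂ) ^ 2) / 2) = (1 - (d : RatFunc ℂ) ^ 2) / 2 := by
  rw [map_div₀, map_sub, map_pow, map_natCast, map_one, C_two]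

/-- The recursion provides a truncated Frobenius solution t^((1-d)/2) P, correct up to t^(d+1) in
the equation multiplied by 2t². Its logarithmic derivative P'/P - (d-1)/(2t) is the required g, and
dividing by t² leaves the error t^(d-1). -/
theorem HasExpansion.hasRiccati {Ψ : RatFunc ℂ} {c : ℂ} {d : ℕ} {a : ℕ → ℂ} (hd : 1 ≤ d)
    (h : HasExpansion Ψ c d a) (h0 : a 0 = (1 - (d : ℂ) ^ 2) / 2) (hY : a d = Y d a) :
    HasRiccati Ψ c d := by
  obtain ⟨s, hs, hΨ⟩ := h
  obtain ⟨b, hb0, hb⟩ := (eq_Y_iff hd a).1 hY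
  have ht := param_ne_zero c
  set t := param c with htdef
  set A := ∑ n ∈ Finset.range (d + 1), Polynomial.monomial n (a n) with hA
  set P := ∑ n ∈ Finset.range (d + 1), Polynomial.monomial n (b n) with hP
  set B := A - Polynomial.C (a 0) with hB
  obtain ⟨r, hr, hLr⟩ := exists_aeval_eq_pow_mul (c := c) (N := d + 1) (P := frobenius d B P) (by
    intro n hn
    have hB0 : B.coeff 0 = 0 := by
      rw [hB, Polynomial.coeff_sub, hA, coeff_sum_monomial _ _ (Nat.zero_le d),
        Polynomial.coeff_C_zero, sub_self]
    rw [coeff_frobenius, hB0, add_zero]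
    rcases Nat.eq_zero_or_pos n with rfl | hpos
    · simp
    · rw [← hb n hpos (by omega), hP, coeff_sum_monomial _ _ (by omega)]
      congr 1
      refine Finset.sum_congr rfl fun k hk => ?_
      rw [Finset.mem_range] at hk
      rw [coeff_sum_monomial _ _ (by omega), hB, Polynomial.coeff_sub, hA,
        coeff_sum_monomial _ _ (by omega), Polynomial.coeff_C, if_neg (by omega), sub_zero])
  set p := Polynomial.aeval t P with hp
  have hpu : IsUnitAt c p := by
    rw [hp, htdef, aeval_param_eq]
    refine isUnitAt_C_add ?_ (aeval_param_mem c _)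
    rw [hP, coeff_sum_monomial _ _ (Nat.zero_le d), hb0]
    exact one_ne_zero
  have hp0 := hpu.1
  have haB : Polynomial.aeval t B = Polynomial.aeval t A - (1 - (d : RatFunc ℂ) ^ 2) / 2 := by
    rw [hB, map_sub, Polynomial.aeval_C, h0, ← C_leading]; rfl
  rw [aeval_frobenius, ← htdef, ← hp, haB] at hLr
  refine ⟨𝐃 p / p - ((d : RatFunc ℂ) - 1) / 2 / t, ?_, (r + s * p) * p⁻¹ / 2, ?_, ?_⟩
  · rw [C_half_sub_one, sub_add_cancel, div_eq_mul_inv]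
    exact mul_mem (ratDeriv_mem_regularAt hpu.2.1) hpu.2.2
  · exact half_mem_regularAt (mul_mem (add_mem hr (mul_mem hs hpu.2.1)) hpu.2.2)
  · have hDt : 𝐃 t = 1 := ratDeriv_param c
    have hDg : 𝐃 (𝐃 p / p - ((d : RatFunc ℂ) - 1) / 2 / t)
        = (𝐃 (𝐃 p) * p - 𝐃 p * 𝐃 p) / p ^ 2 + ((d : RatFunc ℂ) - 1) / 2 / t ^ 2 := by
      rw [map_sub, ratDeriv_quot _ _ hp0, ← C_half_sub_one, ratDeriv_quot _ _ ht, ratDeriv_C, hDt]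
      ring
    obtain ⟨n, rfl⟩ : ∃ n, d = n + 1 := ⟨d - 1, by omega⟩
    rw [hDg, Nat.add_sub_cancel]
    have ht2 : t ^ 2 ≠ 0 := pow_ne_zero 2 ht
    apply mul_left_cancel₀ (mul_ne_zero (mul_ne_zero two_ne_zero ht2) hp0)
    push_cast at hLr ⊢
    field_simp
    linear_combination 2 * p * hLr + 2 * p ^ 2 * hΨ

/-- A polynomial substitute for exp ∫ k, improved by one power of t at a time: subtracting a/(N+1)
t^(N+1) removes the leading error a t^N. -/
theorem exists_exp_truncation {c : ℂ} {k : RatFunc ℂ} (hk : k ∈ 𝓞 c) (N : ℕ) :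
    ∃ P : Polynomial ℂ, P.coeff 0 = 1 ∧ ∃ s ∈ 𝓞 c,
      𝐃 (Polynomial.aeval (param c) P) = k * Polynomial.aeval (param c) P + param c ^ N * s := by
  induction N with
  | zero => exact ⟨1, by simp, -k, neg_mem hk, by simp⟩
  | succ N ih =>
    obtain ⟨P, hP0, s, hs, hP⟩ := ih
    obtain ⟨a, r, hr, rfl⟩ := exists_value hs
    have hN : ((N : RatFunc ℂ) + 1) ≠ 0 := by exact_mod_cast Nat.succ_ne_zero N
    have hN' : (N : ℂ) + 1 ≠ 0 := by exact_mod_cast Nat.succ_ne_zero N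
    set b : RatFunc ℂ := RatFunc.C (a / (N + 1)) with hb
    have hba : b * (N + 1) = RatFunc.C a := by
      have : (N : RatFunc ℂ) + 1 = RatFunc.C ((N : ℂ) + 1) := by simp
      rw [hb, this, ← map_mul, div_mul_cancel₀ _ hN']
    refine ⟨P - Polynomial.monomial (N + 1) (a / (N + 1)), by simp [hP0, Polynomial.coeff_monomial],
      r + k * b, add_mem hr (mul_mem hk (C_mem_regularAt _ _)), ?_⟩
    have hm : Polynomial.aeval (param c) (Polynomial.monomial (N + 1) (a / (N + 1) : ℂ))
        = b * param c ^ (N + 1) := by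
      rw [Polynomial.aeval_monomial]; rfl
    rw [map_sub, map_sub, hP, hm, ratDeriv_mul, ratDeriv_pow, hb, ratDeriv_C, ratDeriv_param, ← hb,
      Nat.add_sub_cancel]
    push_cast
    linear_combination (-param c ^ N) * hba

theorem HasRiccati.param_sq_mul_mem {Ψ : RatFunc ℂ} {c : ℂ} {d : ℕ} (h : HasRiccati Ψ c d) :
    param c ^ 2 * Ψ ∈ 𝓞 c := by
  obtain ⟨g, hg, s, hs, hgs⟩ := h
  have ht := param_ne_zero c
  have htm := param_mem_regularAt c c
  set k := g + RatFunc.C (((d : ℂ) - 1) / 2) / param c with hk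
  set β := RatFunc.C (((d : ℂ) - 1) / 2) with hβ
  have hβm : β ∈ 𝓞 c := C_mem_regularAt _ _
  have hgk : g = k - β / param c := by rw [hk]; ring
  have hDg : 𝐃 g = 𝐃 k + β / param c ^ 2 := by
    rw [hgk, map_sub, ratDeriv_quot _ _ ht, hβ, ratDeriv_C, ratDeriv_param]; ring
  have : param c ^ 2 * Ψ = 2 * (param c ^ 2 * (param c ^ (d - 1) * s) - (param c ^ 2 * 𝐃 k + β)
      - (param c * k - β) ^ 2) := by
    rw [← hgs, hDg, hgk]
    field_simp
    ring
  rw [this]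
  refine mul_mem (ofNat_mem _ 2) (sub_mem (sub_mem (mul_mem (pow_mem htm _)
    (mul_mem (pow_mem htm _) hs)) (add_mem (mul_mem (pow_mem htm _) (ratDeriv_mem_regularAt hg))
    hβm)) (pow_mem (sub_mem (mul_mem htm hg) hβm) 2))

/-- The regular part k of g is integrated to P with P' ≡ kP modulo t^d, so that t^((1-d)/2) P is an
approximate solution. The Riccati error t^(d-1) becomes t^(d+1) after multiplication by t², hence
the Frobenius recursion holds through the resonant index n = d. -/
theorem HasRiccati.of_hasExpansion {Ψ : RatFunc ℂ} {c : ℂ} {d : ℕ} {a : ℕ → ℂ} (hd : 1 ≤ d)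
    (h : HasRiccati Ψ c d) (ha : HasExpansion Ψ c d a) :
    a 0 = (1 - (d : ℂ) ^ 2) / 2 ∧ a d = Y d a := by
  obtain ⟨g, hg, s, hs, hgs⟩ := h
  obtain ⟨e, he, hΨ⟩ := ha
  have ht := param_ne_zero c
  have htm := param_mem_regularAt c c
  set k := g + RatFunc.C (((d : ℂ) - 1) / 2) / param c with hk
  obtain ⟨P, hP0, r, hr, hPr⟩ := exists_exp_truncation hg d
  have hgk : g = k - ((d : RatFunc ℂ) - 1) / 2 / param c := by
    rw [hk, C_half_sub_one]; ring
  have hDt : 𝐃 (param c) = 1 := ratDeriv_param c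
  have hDg : 𝐃 g = 𝐃 k + ((d : RatFunc ℂ) - 1) / 2 / param c ^ 2 := by
    rw [hgk, map_sub, ← C_half_sub_one, ratDeriv_quot _ _ ht, ratDeriv_C, ratDeriv_param]; ring
  set t := param c with htdef
  set A := ∑ n ∈ Finset.range (d + 1), Polynomial.monomial n (a n) with hA
  set p := Polynomial.aeval t P with hp
  have hpm : p ∈ 𝓞 c := aeval_param_mem c P
  set B := A - Polynomial.C ((1 - (d : ℂ) ^ 2) / 2) with hB
  have haB : Polynomial.aeval t B = Polynomial.aeval t A - (1 - (d : RatFunc ℂ) ^ 2) / 2 := by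
    rw [hB, map_sub, Polynomial.aeval_C, ← C_leading]; rfl
  have hL : Polynomial.aeval t (frobenius d B P) = t ^ (d + 1) *
      (2 * p * s - p * e + 2 * (t * (k * r)) + 2 * (d * r + t * 𝐃 r) - 2 * (d - 1) * r) := by
    rw [aeval_frobenius, ← htdef, ← hp, haB, hPr, map_add, ratDeriv_mul, ratDeriv_mul, hPr,
      ratDeriv_pow, hDt]
    rw [hDg, hgk] at hgs
    obtain ⟨n, rfl⟩ : ∃ n, d = n + 1 := ⟨d - 1, by omega⟩
    rw [Nat.add_sub_cancel] at hgs ⊢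
    field_simp at hgs
    push_cast at hgs hΨ ⊢
    linear_combination p / 2 * hgs - p * hΨ
  have hz : ∀ n < d + 1, (frobenius d B P).coeff n = 0 := fun n hn =>
    coeff_eq_zero_of_aeval_eq (d + 1) _ (by
      have hdm : (d : RatFunc ℂ) ∈ 𝓞 c := natCast_mem _ d
      have h2 : (2 : RatFunc ℂ) ∈ 𝓞 c := ofNat_mem _ 2
      exact sub_mem (add_mem (add_mem (sub_mem (mul_mem (mul_mem h2 hpm) hs) (mul_mem hpm he))
        (mul_mem h2 (mul_mem htm (mul_mem hg hr)))) (mul_mem h2 (add_mem (mul_mem hdm hr)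
        (mul_mem htm (ratDeriv_mem_regularAt hr))))) (mul_mem (mul_mem h2 (sub_mem hdm (one_mem _)))
        hr)) hL hn
  have ha0 : a 0 = (1 - (d : ℂ) ^ 2) / 2 := by
    have := hz 0 (by omega)
    rw [coeff_frobenius, hP0, hB, Polynomial.coeff_sub, hA, coeff_sum_monomial _ _ (Nat.zero_le d),
      Polynomial.coeff_C_zero] at this
    simpa [sub_eq_zero] using this
  refine ⟨ha0, (eq_Y_iff hd a).2 ⟨P.coeff, hP0, fun n hn hnd => ?_⟩⟩
  have := hz n (by omega)
  have hB0 : B.coeff 0 = 0 := by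
    rw [hB, Polynomial.coeff_sub, hA, coeff_sum_monomial _ _ (Nat.zero_le d),
      Polynomial.coeff_C_zero, ha0, sub_self]
  rw [coeff_frobenius, hB0, add_zero] at this
  rw [← this]
  congr 1
  refine Finset.sum_congr rfl fun k hk => ?_
  rw [Finset.mem_range] at hk
  rw [hB, Polynomial.coeff_sub, hA,
        coeff_sum_monomial _ _ (by omega), Polynomial.coeff_C, if_neg (by omega), sub_zero]

/-! ### Growth at infinity -/

theorem param_zero : param 0 = RatFunc.X := by simp [param]

theorem X_ne_zero : (RatFunc.X : RatFunc ℂ) ≠ 0 := RatFunc.X_ne_zero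

theorem nonconstant_X_inv : Nonconstant (RatFunc.X : RatFunc ℂ)⁻¹ := by
  apply nonconstant_of_ratDeriv_ne_zero
  rw [ratDeriv_inv, ratDeriv_X]
  exact div_ne_zero (neg_ne_zero.2 one_ne_zero) (pow_ne_zero _ X_ne_zero)

theorem nonconstant_X : Nonconstant (RatFunc.X : RatFunc ℂ) :=
  nonconstant_of_ratDeriv_ne_zero (by simp)

/-- The substitution of `1/X` for `X`. -/
def invert : RatFunc ℂ →ₐ[ℂ] RatFunc ℂ := subst RatFunc.X⁻¹ nonconstant_X_inv

theorem invert_X : invert RatFunc.X = RatFunc.X⁻¹ := subst_X _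

theorem invert_C (a : ℂ) : invert (RatFunc.C a) = RatFunc.C a := subst_C _ a

/-- The order of growth of `u` at infinity is at most `n`. -/
def DegLE (u : RatFunc ℂ) (n : ℤ) : Prop := RatFunc.X ^ n * invert u ∈ 𝓞 0

theorem X_mem_regularAt (c : ℂ) : (RatFunc.X : RatFunc ℂ) ∈ 𝓞 c := by
  rw [← param_zero]; exact param_mem_regularAt c 0

theorem DegLE.mono {u : RatFunc ℂ} {n m : ℤ} (h : DegLE u n) (hnm : n ≤ m) : DegLE u m := by
  obtain ⟨k, hk⟩ : ∃ k : ℕ, m = k + n := ⟨(m - n).toNat, by omega⟩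
  unfold DegLE at *
  rw [hk, zpow_add₀ X_ne_zero, zpow_natCast, mul_assoc]
  exact mul_mem (pow_mem (X_mem_regularAt 0) k) h

theorem DegLE.add {u v : RatFunc ℂ} {n : ℤ} (hu : DegLE u n) (hv : DegLE v n) : DegLE (u + v) n := by
  unfold DegLE at *
  rw [map_add, mul_add]; exact add_mem hu hv

theorem DegLE.neg {u : RatFunc ℂ} {n : ℤ} (hu : DegLE u n) : DegLE (-u) n := by
  unfold DegLE at *
  rw [map_neg, mul_neg]; exact neg_mem hu

theorem DegLE.sub {u v : RatFunc ℂ} {n : ℤ} (hu : DegLE u n) (hv : DegLE v n) : DegLE (u - v) n := by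
  rw [sub_eq_add_neg]; exact hu.add hv.neg

theorem DegLE.mul {u v : RatFunc ℂ} {n m : ℤ} (hu : DegLE u n) (hv : DegLE v m) :
    DegLE (u * v) (n + m) := by
  unfold DegLE at *
  rw [map_mul, zpow_add₀ X_ne_zero, mul_mul_mul_comm]; exact mul_mem hu hv

theorem DegLE.half {u : RatFunc ℂ} {n : ℤ} (hu : DegLE u n) : DegLE (u / 2) n := by
  unfold DegLE at *
  rw [map_div₀, map_ofNat, ← mul_div_assoc]; exact half_mem_regularAt hu

theorem invert_ratDeriv (u : RatFunc ℂ) :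
    invert (𝐃 u) = -(RatFunc.X ^ 2 * 𝐃 (invert u)) := by
  have h := ratDeriv_subst nonconstant_X_inv u
  have hX := X_ne_zero
  rw [ratDeriv_inv, ratDeriv_X] at h
  change 𝐃 (invert u) = invert (𝐃 u) * _ at h
  rw [h]
  field_simp

/-- In w = 1/X the derivation is -w² d/dw, which gains one order at w = 0. -/
theorem DegLE.ratDeriv {u : RatFunc ℂ} {n : ℤ} (hu : DegLE u n) : DegLE (ratDeriv u) (n - 1) := by
  unfold DegLE at *
  have hX := X_ne_zero
  have hz : (RatFunc.X : RatFunc ℂ) ^ n = RatFunc.X ^ (n - 1) * RatFunc.X := by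
    rw [← zpow_add_one₀ hX, sub_add_cancel]
  have : RatFunc.X ^ (n - 1) * invert (𝐃 u)
      = (n : RatFunc ℂ) * (RatFunc.X ^ n * invert u) - RatFunc.X * 𝐃 (RatFunc.X ^ n * invert u) := by
    rw [invert_ratDeriv, ratDeriv_mul, ratDeriv_zpow _ hX, ratDeriv_X, hz]
    ring
  rw [this]
  exact sub_mem (mul_mem (intCast_mem _ n) hu)
    (mul_mem (X_mem_regularAt 0) (ratDeriv_mem_regularAt hu))

theorem exists_degLE (u : RatFunc ℂ) : ∃ n : ℤ, DegLE u n := by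
  obtain ⟨n, hn⟩ := exists_pow_mul_mem 0 (invert u)
  refine ⟨n, ?_⟩
  rwa [DegLE, zpow_natCast, ← param_zero]

theorem denom_eval_ne_zero {c : ℂ} {u : RatFunc ℂ} (hu : u ∈ 𝓞 c) : u.denom.eval c ≠ 0 := by
  obtain ⟨p, q, hq, rfl⟩ := hu
  have hq0 : q ≠ 0 := by rintro rfl; simp at hq
  obtain ⟨r, hr⟩ := RatFunc.denom_div_dvd p q
  intro h
  apply hq
  rw [hr, Polynomial.eval_mul, h, zero_mul]

theorem exists_polynomial_of_regular {u : RatFunc ℂ} (hu : ∀ c, u ∈ 𝓞 c) : ∃ p, u = ι p := by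
  have hdeg : u.denom.degree = 0 := by
    by_contra hne
    obtain ⟨c, hc⟩ := IsAlgClosed.exists_root u.denom hne
    exact denom_eval_ne_zero (hu c) hc
  have h1 : u.denom = 1 := by
    rw [Polynomial.eq_C_of_degree_eq_zero hdeg]
    have := RatFunc.monic_denom u
    rw [Polynomial.Monic, Polynomial.leadingCoeff, Polynomial.natDegree_eq_of_degree_eq_some hdeg] at this
    change u.denom.coeff 0 = 1 at this
    rw [this, map_one]
  refine ⟨u.num, ?_⟩
  conv_lhs => rw [← RatFunc.num_div_denom u, h1, map_one, div_one]

/-- Regularity everywhere leaves a polynomial. If it were nonzero, its reverse would have the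
leading coefficient as value at 0, so its growth at infinity would be exactly its degree, which is
not negative. -/
theorem eq_zero_of_regular_of_degLE {u : RatFunc ℂ} (hu : ∀ c, u ∈ 𝓞 c) (h : DegLE u (-1)) :
    u = 0 := by
  obtain ⟨P, rfl⟩ := exists_polynomial_of_regular hu
  by_contra hP
  have hP0 : P ≠ 0 := by rintro rfl; simp at hP
  have hX := X_ne_zero
  have hrev : invert (ι P) = RatFunc.X ^ (-(P.natDegree : ℤ)) * ι P.reverse := by
    let _ : Invertible ((RatFunc.X : RatFunc ℂ)⁻¹) := invertibleOfNonzero (inv_ne_zero hX)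
    have h := Polynomial.eval₂_reverse_mul_pow (algebraMap ℂ (RatFunc ℂ)) (RatFunc.X : RatFunc ℂ)⁻¹ P
    rw [invOf_eq_inv, inv_inv] at h
    have h2 : ι P.reverse = Polynomial.aeval (RatFunc.X : RatFunc ℂ) P.reverse := by
      rw [RatFunc.aeval_X_left_eq_algebraMap]
    rw [invert, subst_algebraMap, Polynomial.aeval_def, ← h, h2, Polynomial.aeval_def, zpow_neg,
      zpow_natCast, inv_pow, mul_comm]
  have hunit : IsUnitAt 0 (ι P.reverse) := by
    apply isUnitAt_algebraMap
    rw [← Polynomial.coeff_zero_eq_eval_zero, Polynomial.coeff_zero_reverse]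
    exact Polynomial.leadingCoeff_ne_zero.2 hP0
  rw [DegLE, hrev, ← mul_assoc, ← zpow_add₀ hX, ← param_zero, zpow_mul_mem_iff hunit] at h
  omega

theorem degLE_inv_param (c : ℂ) : DegLE (param c)⁻¹ (-1) := by
  have hX := X_ne_zero
  have h0 : RatFunc.C 1 + param 0 * RatFunc.C (-c) ≠ 0 :=
    C_add_ne_zero one_ne_zero (C_mem_regularAt 0 (-c))
  have : RatFunc.X ^ (-1 : ℤ) * invert (param c)⁻¹ = (RatFunc.C 1 + param 0 * RatFunc.C (-c))⁻¹ := by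
    rw [map_inv₀, param, map_sub, invert_X, invert_C, zpow_neg_one, ← mul_inv, param_zero, map_neg,
      map_one]
    congr 1
    field_simp
    ring
  rw [DegLE, this]
  exact C_add_mem_inv one_ne_zero (C_mem_regularAt 0 (-c))

theorem DegLE.C_mul {u : RatFunc ℂ} {n : ℤ} (hu : DegLE u n) (a : ℂ) : DegLE (RatFunc.C a * u) n := by
  unfold DegLE at *
  rw [map_mul, invert_C, mul_left_comm]; exact C_mul_mem_regularAt a hu

theorem degLE_zero (n : ℤ) : DegLE 0 n := by
  unfold DegLE; simp

theorem degLE_sum {α : Type*} (s : Finset α) (f : α → RatFunc ℂ) (n : ℤ) (h : ∀ i ∈ s, DegLE (f i) n) :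
    DegLE (∑ i ∈ s, f i) n := by
  classical
  induction s using Finset.induction_on with
  | empty => exact degLE_zero n
  | insert a s ha ih =>
    rw [Finset.sum_insert ha]
    exact (h a (Finset.mem_insert_self a s)).add (ih fun i hi => h i (Finset.mem_insert_of_mem hi))

/-! ### The connection of a second order equation -/

/-- The operator `(u, v) ↦ (u' + h u - v, v' + h v + Ψ u / 2)`. Its kernel corresponds to the
solutions `y` of `y'' + Ψ y / 2 = 0`, through `(y, y') = y₀ (u, v)` with `y₀' = h y₀`. -/
def nabla (Ψ h : RatFunc ℂ) (m : RatFunc ℂ × RatFunc ℂ) : RatFunc ℂ × RatFunc ℂ :=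
  (𝐃 m.1 + h * m.1 - m.2, 𝐃 m.2 + h * m.2 + Ψ / 2 * m.1)

theorem nabla_add (Ψ h : RatFunc ℂ) (m n : RatFunc ℂ × RatFunc ℂ) :
    nabla Ψ h (m + n) = nabla Ψ h m + nabla Ψ h n := by
  ext <;> simp [nabla] <;> ring

theorem nabla_smul (Ψ h f : RatFunc ℂ) (m : RatFunc ℂ × RatFunc ℂ) :
    nabla Ψ h (f • m) = 𝐃 f • m + f • nabla Ψ h m := by
  ext <;> simp only [nabla, Prod.smul_fst, Prod.smul_snd, Prod.fst_add, Prod.snd_add, smul_eq_mul,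
    ratDeriv_mul] <;> ring

/-- The coefficients `(-X) ^ n / n!`. -/
def expCoeff (n : ℕ) : RatFunc ℂ := RatFunc.C ((-1) ^ n / (n.factorial : ℂ)) * RatFunc.X ^ n

theorem ratDeriv_expCoeff (n : ℕ) : 𝐃 (expCoeff (n + 1)) = -expCoeff n := by
  unfold expCoeff
  rw [ratDeriv_C_mul, ratDeriv_pow, ratDeriv_X, Nat.add_sub_cancel, mul_one, ← mul_assoc]
  have : ((n + 1 : ℕ) : RatFunc ℂ) = RatFunc.C ((n + 1 : ℕ) : ℂ) := (map_natCast RatFunc.C _).symm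
  rw [this, ← map_mul, ← neg_mul, ← map_neg]
  congr 2
  have h1 : (n.factorial : ℂ) ≠ 0 := by exact_mod_cast n.factorial_ne_zero
  have h2 : ((n + 1 : ℕ) : ℂ) ≠ 0 := by exact_mod_cast Nat.succ_ne_zero n
  rw [Nat.factorial_succ]
  push_cast at h2 ⊢
  field_simp
  ring

/-- By the Leibniz rule the sum telescopes. If a power of ∇ kills m, the sum is therefore horizontal
for large n. -/
theorem nabla_sum_expCoeff (Ψ h : RatFunc ℂ) (m : RatFunc ℂ × RatFunc ℂ) (n : ℕ) :
    nabla Ψ h (∑ j ∈ Finset.range (n + 1), expCoeff j • (nabla Ψ h)^[j] m)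
      = expCoeff n • (nabla Ψ h)^[n + 1] m := by
  induction n with
  | zero => simp [expCoeff]
  | succ n ih =>
    rw [Finset.sum_range_succ, nabla_add, ih, nabla_smul, ratDeriv_expCoeff,
      ← Function.iterate_succ_apply' (nabla Ψ h), neg_smul, add_neg_cancel_left]

/-- Vectors on which a power of the connection vanishes are combinations of horizontal vectors. -/
theorem mem_span_horizontal (Ψ h : RatFunc ℂ) (N : ℕ) (m : RatFunc ℂ × RatFunc ℂ)
    (hm : (nabla Ψ h)^[N] m = 0) :
    m ∈ Submodule.span (RatFunc ℂ) {m | nabla Ψ h m = 0} := by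
  induction N using Nat.strong_induction_on generalizing m with
  | _ N ih =>
    rcases N with _ | N
    · rw [Function.iterate_zero, id] at hm
      rw [hm]; exact zero_mem _
    · have h1 := nabla_sum_expCoeff Ψ h m N
      rw [hm, smul_zero] at h1
      have h2 := Submodule.subset_span (R := RatFunc ℂ) (s := {m | nabla Ψ h m = 0}) h1
      rw [SetLike.mem_coe, Finset.sum_range_succ'] at h2
      have h3 : ∑ j ∈ Finset.range N, expCoeff (j + 1) • (nabla Ψ h)^[j + 1] m
          ∈ Submodule.span (RatFunc ℂ) {m | nabla Ψ h m = 0} := by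
        refine Submodule.sum_mem _ fun j hj => Submodule.smul_mem _ _ ?_
        rw [Finset.mem_range] at hj
        refine ih (N - j) (by omega) _ ?_
        rw [← Function.iterate_add_apply]
        have : N - j + (j + 1) = N + 1 := by omega
        rw [this, hm]
      have h4 := (Submodule.add_mem_iff_right _ h3).1 h2
      simpa [expCoeff] using h4

/-- Two independent horizontal vectors give a rational function with Schwarzian `Ψ`. -/
theorem ratSchwarzian_of_horizontal {Ψ h u₁ v₁ u₂ v₂ : RatFunc ℂ} (h₁ : nabla Ψ h (u₁, v₁) = 0)
    (h₂ : nabla Ψ h (u₂, v₂) = 0) (hu : u₂ ≠ 0) (hw : v₁ * u₂ - u₁ * v₂ ≠ 0) :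
    Nonconstant (u₁ / u₂) ∧ ratSchwarzian (u₁ / u₂) = Ψ := by
  simp only [nabla, Prod.mk_eq_zero] at h₁ h₂
  obtain ⟨a1, b1⟩ := h₁
  obtain ⟨a2, b2⟩ := h₂
  have a1' : 𝐃 u₁ = v₁ - h * u₁ := by linear_combination a1
  have a2' : 𝐃 u₂ = v₂ - h * u₂ := by linear_combination a2
  have b1' : 𝐃 v₁ = -h * v₁ - Ψ / 2 * u₁ := by linear_combination b1
  have b2' : 𝐃 v₂ = -h * v₂ - Ψ / 2 * u₂ := by linear_combination b2
  set w := v₁ * u₂ - u₁ * v₂ with hwdef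
  have hDw : 𝐃 w = -2 * h * w := by
    rw [hwdef, map_sub, ratDeriv_mul, ratDeriv_mul, a1', a2', b1', b2']; ring
  have e1 : 𝐃 (u₁ / u₂) = w / u₂ ^ 2 := by
    rw [ratDeriv_quot _ _ hu, a1', a2', hwdef]; ring
  have e2 : 𝐃 (𝐃 (u₁ / u₂)) = RatFunc.C (-2) * (w * v₂ / u₂ ^ 3) := by
    rw [e1, ratDeriv_quot _ _ (pow_ne_zero 2 hu), hDw, ratDeriv_pow, a2', map_neg, C_two]
    push_cast
    field_simp
    ring
  have e3 : 𝐃 (𝐃 (𝐃 (u₁ / u₂))) = w * (Ψ * u₂ ^ 2 + 6 * v₂ ^ 2) / u₂ ^ 4 := by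
    rw [e2, ratDeriv_C_mul, ratDeriv_quot _ _ (pow_ne_zero 3 hu), ratDeriv_mul, hDw, ratDeriv_pow,
      a2', b2', map_neg, C_two]
    push_cast
    field_simp
    ring
  constructor
  · apply nonconstant_of_ratDeriv_ne_zero
    rw [e1]
    exact div_ne_zero hw (pow_ne_zero 2 hu)
  · rw [ratSchwarzian, e3, e2, e1, map_neg, C_two]
    field_simp
    ring

/-- A second order Fuchsian equation on `ℂ ∪ {∞}` without logarithms at the finite singular points
comes from a rational function. -/
theorem exists_ratSchwarzian_eq {Ψ : RatFunc ℂ} {d : ℂ → ℕ} (hd : ∀ c, 1 ≤ d c)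
    (hfin : {c | d c ≠ 1}.Finite) (hR : ∀ c, HasRiccati Ψ c (d c)) (hinf : DegLE Ψ (-2)) :
    ∃ f, Nonconstant f ∧ ratSchwarzian f = Ψ := by
  classical
  choose g hg s hs hgs using hR
  set S := hfin.toFinset with hS
  have hS' : ∀ c, c ∉ S → d c = 1 := fun c hc => by
    by_contra hne; exact hc (by simpa [hS] using hne)
  set β : ℂ → RatFunc ℂ := fun c => RatFunc.C (((d c : ℂ) - 1) / 2) with hβ
  have hβ0 : ∀ c, c ∉ S → β c = 0 := fun c hc => by simp [hβ, hS' c hc]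
  -- This is the logarithmic derivative of y₀ = ∏ (X - b)^((1 - d b)/2). Although y₀ need not be
  -- rational, h is, and it has the same polar part at each c as `g c`.
  set h : RatFunc ℂ := -∑ b ∈ S, β b * (param b)⁻¹ with hh
  have hhinf : DegLE h (-1) :=
    (degLE_sum _ _ _ fun b _ => (degLE_inv_param b).C_mul _).neg
  have hhreg : ∀ c, h + β c / param c ∈ 𝓞 c := by
    intro c
    have hsum : ∑ b ∈ S.erase c, β b * (param b)⁻¹ ∈ 𝓞 c :=
      sum_mem fun b hb => mul_mem (C_mem_regularAt _ _)
        (isUnitAt_param (Finset.ne_of_mem_erase hb).symm).inv.2.1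
    have : h + β c / param c = -∑ b ∈ S.erase c, β b * (param b)⁻¹ := by
      by_cases hc : c ∈ S
      · rw [hh, ← Finset.add_sum_erase S _ hc]; ring
      · rw [hh, Finset.erase_eq_of_notMem hc, hβ0 c hc]; ring
    rw [this]
    exact neg_mem hsum
  -- The lattice of sections. If y₁ solves the equation near c with y₁'/y₁ = g, then y' - g y is a
  -- constant over y₁ for every solution y; after division by y₀ this has order at least d c - 1.
  let InM : RatFunc ℂ × RatFunc ℂ → Prop := fun m =>
    ∀ c, m.1 ∈ 𝓞 c ∧ ∃ r ∈ 𝓞 c, m.2 - g c * m.1 = param c ^ (d c - 1) * r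
  have hstable : ∀ m, InM m → InM (nabla Ψ h m) := by
    intro m hm c
    obtain ⟨hu, r, hr, hw⟩ := hm c
    obtain ⟨u, v⟩ := m
    simp only [nabla] at hu hw ⊢
    have htm := param_mem_regularAt c c
    have ht := param_ne_zero c
    have hk : h - g c ∈ 𝓞 c := by
      have := sub_mem (hhreg c) (hg c)
      rwa [add_sub_add_right_eq_sub] at this
    refine ⟨?_, 𝐃 r + (h + β c / param c + (g c + β c / param c)) * r + u * s c, ?_, ?_⟩
    · have : 𝐃 u + h * u - v = 𝐃 u + (h - g c) * u - param c ^ (d c - 1) * r := by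
        rw [← hw]; ring
      rw [this]
      exact sub_mem (add_mem (ratDeriv_mem_regularAt hu) (mul_mem hk hu))
        (mul_mem (pow_mem htm _) hr)
    · exact add_mem (add_mem (ratDeriv_mem_regularAt hr) (mul_mem (add_mem (hhreg c) (hg c)) hr))
        (mul_mem hu (hs c))
    · have hDw := congrArg ratDeriv hw
      -- The pole of h + g c, with residue -(d c - 1), is exactly compensated by differentiating
      -- t^(d c - 1). Together with the Riccati equation modulo t^(d c - 1), this makes the lattice
      -- stable.
      have hDt : 𝐃 (param c ^ (d c - 1)) = param c ^ (d c - 1) * (2 * (β c / param c)) := by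
        have hβd : 2 * β c = ((d c - 1 : ℕ) : RatFunc ℂ) := by
          rw [hβ]
          simp only
          rw [C_half_sub_one, Nat.cast_sub (hd c)]
          push_cast
          ring
        rw [ratDeriv_pow, ratDeriv_param, ← mul_div_assoc, hβd]
        obtain ⟨n, hn⟩ : ∃ n, d c = n + 1 := ⟨d c - 1, by have := hd c; omega⟩
        rw [hn, Nat.add_sub_cancel]
        rcases n with _ | n
        · simp
        · rw [Nat.add_sub_cancel]
          field_simp
          ring
      rw [map_sub, ratDeriv_mul, ratDeriv_mul, hDt] at hDw
      linear_combination hDw + (h + g c) * hw + u * hgs c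
  -- The second component is weighted like a derivative of the first; with h = O(1/X) and Ψ =
  -- O(1/X²), every term of ∇ then lowers the weight by one.
  let wt : ℤ → RatFunc ℂ × RatFunc ℂ → Prop := fun n m => DegLE m.1 n ∧ DegLE m.2 (n - 1)
  have hlower : ∀ n m, wt n m → wt (n - 1) (nabla Ψ h m) := by
    rintro n ⟨u, v⟩ ⟨hu, hv⟩
    refine ⟨(hu.ratDeriv.add ?_).sub hv, (hv.ratDeriv.add ?_).add ?_⟩
    · exact (hhinf.mul hu).mono (by omega)
    · exact (hhinf.mul hv).mono (by omega)
    · exact (hinf.half.mul hu).mono (by omega)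
  have hzero : ∀ m, InM m → wt (-1) m → m = 0 := by
    rintro ⟨u, v⟩ hm ⟨hu, hv⟩
    have hu0 : u = 0 := eq_zero_of_regular_of_degLE (fun c => (hm c).1) hu
    have hv0 : v = 0 := by
      refine eq_zero_of_regular_of_degLE (fun c => ?_) (hv.mono (by omega))
      obtain ⟨-, r, hr, hw⟩ := hm c
      simp only [hu0, mul_zero, sub_zero] at hw
      rw [hw]
      exact mul_mem (pow_mem (param_mem_regularAt c c) _) hr
    rw [hu0, hv0]; rfl
  have hspan : ∀ m, InM m → m ∈ Submodule.span (RatFunc ℂ) {m | nabla Ψ h m = 0} := by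
    intro m hm
    obtain ⟨n₁, hn₁⟩ := exists_degLE m.1
    obtain ⟨n₂, hn₂⟩ := exists_degLE m.2
    -- The extra 1 accounts for the shifted bound n - 1 on the second component.
    set n : ℕ := n₁.natAbs + n₂.natAbs + 1 with hn
    have hw : wt n m := ⟨hn₁.mono (by omega), hn₂.mono (by omega)⟩
    have hiter : ∀ k : ℕ, InM ((nabla Ψ h)^[k] m) ∧ wt (n - k) ((nabla Ψ h)^[k] m) := by
      intro k
      induction k with
      | zero => exact ⟨hm, by simpa using hw⟩
      | succ k ih =>
        rw [Function.iterate_succ_apply']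
        refine ⟨hstable _ ih.1, ?_⟩
        have := hlower _ _ ih.2
        have e : (n : ℤ) - ((k + 1 : ℕ) : ℤ) = n - k - 1 := by push_cast; ring
        rwa [e]
    refine mem_span_horizontal Ψ h (n + 1) m (hzero _ (hiter _).1 ?_)
    have := (hiter (n + 1)).2
    have e : (n : ℤ) - ((n + 1 : ℕ) : ℤ) = -1 := by push_cast; ring
    rwa [e] at this
  -- One power more than the lattice modulus, to absorb the simple pole of `g b`; thus both (q, 0)
  -- and (0, q) are sections.
  set q : RatFunc ℂ := ∏ b ∈ S, param b ^ d b with hq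
  have hq0 : q ≠ 0 := Finset.prod_ne_zero_iff.2 fun b _ => pow_ne_zero _ (param_ne_zero b)
  have hqfac : ∀ c, ∃ r ∈ 𝓞 c, q = param c ^ (d c - 1) * r ∧ g c * r ∈ 𝓞 c := by
    intro c
    have hr : ∏ b ∈ S.erase c, param b ^ d b ∈ 𝓞 c :=
      prod_mem fun b _ => pow_mem (param_mem_regularAt c b) _
    have ht := param_ne_zero c
    by_cases hc : c ∈ S
    · refine ⟨param c * ∏ b ∈ S.erase c, param b ^ d b, mul_mem (param_mem_regularAt c c) hr, ?_, ?_⟩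
      · obtain ⟨n, hn⟩ : ∃ n, d c = n + 1 := ⟨d c - 1, by have := hd c; omega⟩
        rw [hq, ← Finset.mul_prod_erase S _ hc, hn, Nat.add_sub_cancel]
        ring
      · have : g c * (param c * ∏ b ∈ S.erase c, param b ^ d b)
            = (param c * (g c + β c / param c) - β c) * ∏ b ∈ S.erase c, param b ^ d b := by
          field_simp
          ring
        rw [this]
        exact mul_mem (sub_mem (mul_mem (param_mem_regularAt c c) (hg c)) (C_mem_regularAt _ _)) hr
    · rw [Finset.erase_eq_of_notMem hc] at hr
      refine ⟨q, hr, by rw [hS' c hc]; simp, mul_mem ?_ hr⟩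
      have := hg c
      rw [hS' c hc] at this
      simpa using this
  have hq₁ : InM (q, 0) := by
    intro c
    obtain ⟨r, hr, hqr, hgr⟩ := hqfac c
    refine ⟨?_, -(g c * r), neg_mem hgr, ?_⟩
    · simp only
      rw [hqr]; exact mul_mem (pow_mem (param_mem_regularAt c c) _) hr
    · simp only
      rw [hqr]; ring
  have hq₂ : InM (0, q) := by
    intro c
    obtain ⟨r, hr, hqr, -⟩ := hqfac c
    exact ⟨zero_mem _, r, hr, by simpa using hqr⟩
  -- Since (q, 0) is in the span, the horizontal vectors cannot all have first component zero.
  obtain ⟨⟨u₂, v₂⟩, h₂, hu₂⟩ : ∃ m, nabla Ψ h m = 0 ∧ m.1 ≠ 0 := by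
    by_contra! hcon
    have hle : Submodule.span (RatFunc ℂ) {m | nabla Ψ h m = 0}
        ≤ LinearMap.ker (LinearMap.fst (RatFunc ℂ) (RatFunc ℂ) (RatFunc ℂ)) :=
      Submodule.span_le.2 fun m hm => hcon m hm
    exact hq0 (hle (hspan _ hq₁))
  -- Since (0, q) is in the span, they cannot all be proportional to (u₂, v₂).
  obtain ⟨⟨u₁, v₁⟩, h₁, hw⟩ : ∃ m, nabla Ψ h m = 0 ∧ m.2 * u₂ - m.1 * v₂ ≠ 0 := by
    by_contra! hcon
    have hle : Submodule.span (RatFunc ℂ) {m | nabla Ψ h m = 0}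
        ≤ LinearMap.ker (u₂ • LinearMap.snd (RatFunc ℂ) (RatFunc ℂ) (RatFunc ℂ)
          - v₂ • LinearMap.fst (RatFunc ℂ) (RatFunc ℂ) (RatFunc ℂ)) :=
      Submodule.span_le.2 fun m hm => by
        have := hcon m hm
        rw [SetLike.mem_coe, LinearMap.mem_ker]
        simp only [LinearMap.sub_apply, LinearMap.smul_apply, LinearMap.snd_apply,
          LinearMap.fst_apply, smul_eq_mul]
        linear_combination this
    have := hle (hspan _ hq₂)
    rw [LinearMap.mem_ker] at this
    simp only [LinearMap.sub_apply, LinearMap.smul_apply, LinearMap.snd_apply,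
      LinearMap.fst_apply, smul_eq_mul, mul_zero, sub_zero, mul_eq_zero] at this
    exact this.elim hu₂ hq0
  exact ⟨_, ratSchwarzian_of_horizontal h₁ h₂ hu₂ hw⟩

/-! ### Rational functions as meromorphic functions -/

theorem toFun_eq (u : RatFunc ℂ) (z : ℂ) : toFun u z = u.num.eval z / u.denom.eval z := rfl

theorem toFun_div {p q : Polynomial ℂ} {z : ℂ} (hq : q.eval z ≠ 0) :
    toFun (ι p / ι q) z = p.eval z / q.eval z := by
  set u := ι p / ι q with hu
  have hq0 : q ≠ 0 := by rintro rfl; simp at hq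
  have hM' := algebraMap_ne_zero (RatFunc.denom_ne_zero u)
  have hq' := algebraMap_ne_zero hq0
  have hd := denom_eval_ne_zero (c := z) (u := u) ⟨p, q, hq, rfl⟩
  have h0 : u.num * q = p * u.denom := by
    apply RatFunc.algebraMap_injective ℂ
    have h := RatFunc.num_div_denom u
    rw [div_eq_iff hM', hu] at h
    rw [map_mul, map_mul, h, ← hu, hu]
    field_simp
  rw [toFun_eq, div_eq_div_iff hd hq, ← Polynomial.eval_mul, h0, Polynomial.eval_mul]

theorem mem_regularAt_iff {u : RatFunc ℂ} {z : ℂ} : u ∈ 𝓞 z ↔ u.denom.eval z ≠ 0 :=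
  ⟨denom_eval_ne_zero, fun h => ⟨u.num, u.denom, h, (RatFunc.num_div_denom u).symm⟩⟩

/-- Evaluation gives a junk value at poles, hence the regularity hypotheses here and the cofinite
filters in later statements. -/
theorem toFun_add {u v : RatFunc ℂ} {z : ℂ} (hu : u ∈ 𝓞 z) (hv : v ∈ 𝓞 z) :
    toFun (u + v) z = toFun u z + toFun v z :=
  RatFunc.eval_add _ _ (denom_eval_ne_zero hu) (denom_eval_ne_zero hv)

theorem toFun_mul {u v : RatFunc ℂ} {z : ℂ} (hu : u ∈ 𝓞 z) (hv : v ∈ 𝓞 z) :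
    toFun (u * v) z = toFun u z * toFun v z :=
  RatFunc.eval_mul _ _ (denom_eval_ne_zero hu) (denom_eval_ne_zero hv)

@[simp] theorem toFun_C (a z : ℂ) : toFun (RatFunc.C a) z = a := by simp [toFun]

@[simp] theorem toFun_X (z : ℂ) : toFun RatFunc.X z = z := by simp [toFun]

theorem toFun_algebraMap (p : Polynomial ℂ) (z : ℂ) : toFun (ι p) z = p.eval z := by
  simpa using toFun_div (p := p) (q := 1) (z := z) (by simp)

@[simp] theorem toFun_param (c z : ℂ) : toFun (param c) z = z - c := by
  rw [param_eq, toFun_algebraMap]; simp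

theorem toFun_sub {u v : RatFunc ℂ} {z : ℂ} (hu : u ∈ 𝓞 z) (hv : v ∈ 𝓞 z) :
    toFun (u - v) z = toFun u z - toFun v z := by
  have h := toFun_add (sub_mem hu hv) hv
  rw [sub_add_cancel] at h
  rw [h]; ring

theorem toFun_pow {u : RatFunc ℂ} {z : ℂ} (hu : u ∈ 𝓞 z) (n : ℕ) :
    toFun (u ^ n) z = toFun u z ^ n := by
  induction n with
  | zero => simpa using toFun_C 1 z
  | succ n ih => rw [pow_succ, toFun_mul (pow_mem hu n) hu, ih, pow_succ]

theorem toFun_inv {u : RatFunc ℂ} {z : ℂ} (hu : IsUnitAt z u) : toFun u⁻¹ z = (toFun u z)⁻¹ := by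
  have h := toFun_mul hu.2.1 hu.2.2
  rw [mul_inv_cancel₀ hu.1, ← map_one RatFunc.C, toFun_C] at h
  exact (inv_eq_of_mul_eq_one_right h.symm).symm

theorem IsUnitAt.toFun_ne_zero {u : RatFunc ℂ} {z : ℂ} (hu : IsUnitAt z u) : toFun u z ≠ 0 := by
  have h := toFun_mul hu.2.1 hu.2.2
  rw [mul_inv_cancel₀ hu.1, ← map_one RatFunc.C, toFun_C] at h
  exact left_ne_zero_of_mul (h ▸ one_ne_zero)

theorem eventually_regularAt (u : RatFunc ℂ) : ∀ᶠ z in cofinite, u ∈ 𝓞 z := by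
  have h : {z | ¬ u ∈ 𝓞 z} ⊆ {z | u.denom.IsRoot z} := fun z hz => by
    rw [Set.mem_ofPred_eq, mem_regularAt_iff, not_not] at hz; exact hz
  exact (Polynomial.finite_setOfPred_isRoot (RatFunc.denom_ne_zero u)).subset h

theorem eventually_isUnitAt {u : RatFunc ℂ} (hu : u ≠ 0) : ∀ᶠ z in cofinite, IsUnitAt z u := by
  filter_upwards [eventually_regularAt u, eventually_regularAt u⁻¹] with z h1 h2
  exact ⟨hu, h1, h2⟩

theorem eventually_nhdsNE_of_cofinite {P : ℂ → Prop} (h : ∀ᶠ z in cofinite, P z) (c : ℂ) :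
    ∀ᶠ w in 𝓝[≠] (0 : ℂ), P (c + w) := by
  have h1 : Tendsto (fun w : ℂ => c + w) cofinite cofinite :=
    (add_right_injective c).tendsto_cofinite
  exact (h1.eventually h).filter_mono (nhdsNE_le_cofinite 0)

theorem eventually_nhds_regularAt {u : RatFunc ℂ} {z : ℂ} (hu : u ∈ 𝓞 z) : ∀ᶠ x in 𝓝 z, u ∈ 𝓞 x := by
  have hc : Continuous fun x => u.denom.eval x := u.denom.continuous
  filter_upwards [hc.continuousAt.eventually_ne (denom_eval_ne_zero hu)] with x hx
  exact mem_regularAt_iff.2 hx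

theorem analyticAt_toFun {u : RatFunc ℂ} {z : ℂ} (hu : u ∈ 𝓞 z) : AnalyticAt ℂ (toFun u) z := by
  have h : ∀ p : Polynomial ℂ, AnalyticAt ℂ (fun x => p.eval x) z := fun p =>
    p.differentiable.analyticAt z
  exact (h u.num).div (h u.denom) (denom_eval_ne_zero hu)

theorem analyticAt_toFun_add {u : RatFunc ℂ} {c : ℂ} (hu : u ∈ 𝓞 c) :
    AnalyticAt ℂ (fun w => toFun u (c + w)) 0 := by
  refine AnalyticAt.fun_comp (g := toFun u) ?_ (by fun_prop)
  simpa using analyticAt_toFun hu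

theorem hasDerivAt_toFun {u : RatFunc ℂ} {z : ℂ} (hu : u ∈ 𝓞 z) :
    HasDerivAt (toFun u) (toFun (𝐃 u) z) z := by
  have hd := denom_eval_ne_zero hu
  have h := (u.num.hasDerivAt z).div (u.denom.hasDerivAt z) hd
  have h2 : toFun (𝐃 u) z = (u.num.derivative.eval z * u.denom.eval z
      - u.num.eval z * u.denom.derivative.eval z) / u.denom.eval z ^ 2 := by
    conv_lhs => rw [← RatFunc.num_div_denom u]
    rw [ratDeriv_div _ _ (RatFunc.denom_ne_zero u), ← map_mul, ← map_mul, ← map_sub, ← map_pow,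
      toFun_div (by simpa using hd)]
    simp
  rw [h2]
  exact h

theorem deriv_toFun_eventuallyEq {u : RatFunc ℂ} {z : ℂ} (hu : u ∈ 𝓞 z) :
    deriv (toFun u) =ᶠ[𝓝 z] toFun (𝐃 u) := by
  filter_upwards [eventually_nhds_regularAt hu] with x hx
  exact (hasDerivAt_toFun hx).deriv

/-- The algebraic and the analytic Schwarzian derivatives agree. -/
theorem toFun_ratSchwarzian {f : RatFunc ℂ} (hf : Nonconstant f) :
    ∀ᶠ z in cofinite, schwarzian (toFun f) z = toFun (ratSchwarzian f) z := by
  filter_upwards [eventually_regularAt f, eventually_isUnitAt hf.ratDeriv_ne_zero] with z hz hD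
  have e1 := deriv_toFun_eventuallyEq hz
  have e2 := e1.deriv.trans (deriv_toFun_eventuallyEq (ratDeriv_mem_regularAt hz))
  have e3 := e2.deriv.trans
    (deriv_toFun_eventuallyEq (ratDeriv_mem_regularAt (ratDeriv_mem_regularAt hz)))
  have h2 := ratDeriv_mem_regularAt hD.2.1
  have h3 := ratDeriv_mem_regularAt h2
  have h32 : (3 / 2 : RatFunc ℂ) = RatFunc.C (3 / 2) := by
    rw [map_div₀, map_ofNat, map_ofNat]
  rw [schwarzian, iteratedDeriv_succ, iteratedDeriv_succ, iteratedDeriv_succ, iteratedDeriv_zero,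
    e1.eq_of_nhds, e2.eq_of_nhds, e3.eq_of_nhds, ratSchwarzian, h32,
    div_eq_mul_inv (𝐃 (𝐃 (𝐃 f))), div_eq_mul_inv (𝐃 (𝐃 f)),
    toFun_sub (mul_mem h3 hD.2.2) (C_mul_mem_regularAt _ (pow_mem (mul_mem h2 hD.2.2) 2)),
    toFun_mul h3 hD.2.2, toFun_mul (C_mem_regularAt _ _) (pow_mem (mul_mem h2 hD.2.2) 2),
    toFun_pow (mul_mem h2 hD.2.2), toFun_mul h2 hD.2.2, toFun_inv hD, toFun_C]
  ring

theorem toFun_aeval {m : RatFunc ℂ} {z : ℂ} (hm : m ∈ 𝓞 z) (p : Polynomial ℂ) :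
    toFun (Polynomial.aeval m p) z = p.eval (toFun m z) := by
  induction p using Polynomial.induction_on' with
  | add p q hp hq =>
    rw [map_add, toFun_add (aeval_mem_regularAt hm p) (aeval_mem_regularAt hm q), hp, hq,
      Polynomial.eval_add]
  | monomial n a =>
    rw [Polynomial.aeval_monomial, Polynomial.eval_monomial]
    change toFun (RatFunc.C a * m ^ n) z = _
    rw [toFun_mul (C_mem_regularAt _ _) (pow_mem hm n), toFun_C, toFun_pow hm]

theorem toFun_subst {m : RatFunc ℂ} (hm : Nonconstant m) (u : RatFunc ℂ) :
    ∀ᶠ z in cofinite, toFun (subst m hm u) z = toFun u (toFun m z) := by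
  have hq : Polynomial.aeval m u.denom ≠ 0 := by
    rw [Ne, map_eq_zero_iff _ (aeval_injective hm)]; exact RatFunc.denom_ne_zero u
  filter_upwards [eventually_regularAt m, eventually_isUnitAt hq] with z hz hqz
  conv_lhs => rw [← RatFunc.num_div_denom u]
  rw [subst_div, div_eq_mul_inv, toFun_mul (aeval_mem_regularAt hz _) hqz.2.2, toFun_inv hqz,
    toFun_aeval hz, toFun_aeval hz, toFun_eq u, div_eq_mul_inv]

theorem toFun_invert (u : RatFunc ℂ) : ∀ᶠ z in cofinite, toFun (invert u) z = toFun u z⁻¹ := by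
  filter_upwards [toFun_subst nonconstant_X_inv u, eventually_isUnitAt X_ne_zero] with z hz hX
  rw [invert, hz, toFun_inv hX, toFun_X]

theorem toFun_zpow_mul (c : ℂ) (v : RatFunc ℂ) (n : ℤ) :
    (fun w => toFun (param c ^ n * v) (c + w))
      =ᶠ[𝓝[≠] 0] fun w => w ^ n * toFun v (c + w) := by
  filter_upwards [eventually_nhdsNE_of_cofinite (eventually_isUnitAt (param_ne_zero c)) c,
    eventually_nhdsNE_of_cofinite (eventually_regularAt v) c] with w h1 h2
  rw [toFun_mul (h1.zpow n).2.1 h2]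
  congr 1
  obtain ⟨k, rfl | rfl⟩ := n.eq_nat_or_neg
  · rw [zpow_natCast, zpow_natCast, toFun_pow h1.2.1, toFun_param, add_sub_cancel_left]
  · rw [zpow_neg, zpow_neg, zpow_natCast, zpow_natCast, ← inv_pow, toFun_pow h1.2.2, toFun_inv h1,
      toFun_param, add_sub_cancel_left, inv_pow]

theorem meromorphicAt_toFun (u : RatFunc ℂ) (c : ℂ) :
    MeromorphicAt (fun w => toFun u (c + w)) 0 := by
  by_cases hu : u = 0
  · have : u ∈ 𝓞 c := by rw [hu]; exact zero_mem _
    exact (analyticAt_toFun_add this).meromorphicAt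
  · obtain ⟨n, v, hv, rfl⟩ := exists_factor c hu
    refine MeromorphicAt.congr ?_ (toFun_zpow_mul c v n).symm
    exact ((MeromorphicAt.id 0).zpow n).mul (analyticAt_toFun_add hv.2.1).meromorphicAt

theorem meromorphicOrderAt_toFun {c : ℂ} {v : RatFunc ℂ} (hv : IsUnitAt c v) (n : ℤ) :
    meromorphicOrderAt (fun w => toFun (param c ^ n * v) (c + w)) 0 = n := by
  rw [meromorphicOrderAt_eq_int_iff (meromorphicAt_toFun _ c)]
  refine ⟨_, analyticAt_toFun_add hv.2.1, by simpa using hv.toFun_ne_zero, ?_⟩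
  filter_upwards [toFun_zpow_mul c v n] with w hw
  rw [hw, sub_zero, smul_eq_mul]

theorem regularAt_iff_order {u : RatFunc ℂ} {c : ℂ} :
    u ∈ 𝓞 c ↔ 0 ≤ meromorphicOrderAt (fun w => toFun u (c + w)) 0 := by
  by_cases hu : u = 0
  · have : u ∈ 𝓞 c := by rw [hu]; exact zero_mem _
    exact ⟨fun _ => (analyticAt_toFun_add this).meromorphicOrderAt_nonneg, fun _ => this⟩
  · obtain ⟨n, v, hv, rfl⟩ := exists_factor c hu
    rw [meromorphicOrderAt_toFun hv, zpow_mul_mem_iff hv]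
    exact_mod_cast Iff.rfl

/-! ### Power series expansions -/

theorem analyticAt_of_hasSum {a : ℕ → ℂ} {F : ℂ → ℂ}
    (h : ∀ᶠ w in 𝓝[≠] (0 : ℂ), HasSum (fun n => a n * w ^ n) (F w)) :
    AnalyticAt ℂ (Function.update F 0 (a 0)) 0 := by
  refine ⟨FormalMultilinearSeries.ofScalars ℂ a, hasFPowerSeriesAt_iff.2 ?_⟩
  rw [eventually_nhdsWithin_iff] at h
  filter_upwards [h] with w hw
  simp only [FormalMultilinearSeries.coeff_ofScalars, smul_eq_mul, zero_add]
  by_cases h0 : w = 0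
  · subst h0
    rw [Function.update_self]
    have h1 := hasSum_single (f := fun n => (0 : ℂ) ^ n * a n) 0 (fun n hn => by simp [hn])
    rwa [pow_zero, one_mul] at h1
  · rw [Function.update_of_ne h0]
    simpa only [mul_comm] using hw h0

/-- The Taylor remainder over t^(d+1) is rational, and off c it is the sum of the shifted power
series; its order at c is therefore nonnegative, which for a rational function means regularity. -/
theorem hasExpansion_of_hasSum {Ψ : RatFunc ℂ} {c : ℂ} {a : ℕ → ℂ}
    (h : ∀ᶠ w in 𝓝[≠] (0 : ℂ), HasSum (fun n => a n * w ^ n) (w ^ 2 * toFun Ψ (c + w))) (d : ℕ) :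
    HasExpansion Ψ c d a := by
  have ht := param_ne_zero c
  set A := ∑ n ∈ Finset.range (d + 1), Polynomial.monomial n (a n) with hA
  set B := (param c ^ 2 * Ψ - Polynomial.aeval (param c) A) * ((param c) ^ (d + 1))⁻¹ with hB
  refine ⟨B, ?_, ?_⟩
  · have hB' : ∀ᶠ w in 𝓝[≠] (0 : ℂ),
        HasSum (fun n => a (n + (d + 1)) * w ^ n) (toFun B (c + w)) := by
      filter_upwards [h, self_mem_nhdsWithin,
        eventually_nhdsNE_of_cofinite (eventually_isUnitAt ht) c,
        eventually_nhdsNE_of_cofinite (eventually_regularAt Ψ) c] with w hw hw0 htw hΨ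
      have hw0 : w ≠ 0 := hw0
      have hval : toFun B (c + w) = (w ^ 2 * toFun Ψ (c + w)
          - ∑ n ∈ Finset.range (d + 1), a n * w ^ n) * (w ^ (d + 1))⁻¹ := by
        have hA' := aeval_mem_regularAt htw.2.1 A
        have hp := pow_mem htw.2.1 2
        rw [hB, ← inv_pow, toFun_mul (sub_mem (mul_mem hp hΨ) hA') (pow_mem htw.2.2 _),
          toFun_sub (mul_mem hp hΨ) hA', toFun_mul hp hΨ, toFun_pow htw.2.1, toFun_aeval htw.2.1,
          toFun_pow htw.2.2, toFun_inv htw, toFun_param, add_sub_cancel_left, inv_pow, hA,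
          Polynomial.eval_finsetSum]
        simp only [Polynomial.eval_monomial]
      rw [hval]
      have h1 := ((hasSum_nat_add_iff' (d + 1)).2 hw).mul_right (w ^ (d + 1))⁻¹
      refine h1.congr_fun fun n => ?_
      rw [pow_add]
      field_simp
    have han := analyticAt_of_hasSum hB'
    rw [regularAt_iff_order, ← meromorphicOrderAt_congr (f₁ := Function.update
      (fun w => toFun B (c + w)) 0 (a (0 + (d + 1))))]
    · exact han.meromorphicOrderAt_nonneg
    · filter_upwards [self_mem_nhdsWithin] with w hw
      exact Function.update_of_ne hw _ _
  · rw [hB]; field_simp; ring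

theorem exists_hasSum {Ψ : RatFunc ℂ} {c : ℂ} (h : param c ^ 2 * Ψ ∈ 𝓞 c) : ∃ a : ℕ → ℂ,
    ∀ᶠ w in 𝓝[≠] (0 : ℂ), HasSum (fun n => a n * w ^ n) (w ^ 2 * toFun Ψ (c + w)) := by
  obtain ⟨P, hP⟩ := analyticAt_toFun_add h
  refine ⟨P.coeff, ?_⟩
  have h1 := (hasFPowerSeriesAt_iff.1 hP).filter_mono (nhdsWithin_le_nhds (s := {0}ᶜ))
  filter_upwards [h1, eventually_nhdsNE_of_cofinite (eventually_regularAt Ψ) c] with w hw hΨ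
  have hp := param_mem_regularAt (c + w) c
  rw [zero_add, toFun_mul (pow_mem hp 2) hΨ, toFun_pow hp, toFun_param, add_sub_cancel_left] at hw
  simpa only [smul_eq_mul, mul_comm] using hw

/-- The local form at `p` amounts to the solvability of the Riccati equation. -/
theorem hasLocalForm_iff {φ : ℂ → ℂ} {p : OnePoint ℂ} {Ψ : RatFunc ℂ} {c : ℂ} {d : ℕ} (hd : 1 ≤ d)
    (h : localCoeff φ p =ᶠ[𝓝[≠] 0] fun w => toFun Ψ (c + w)) :
    HasLocalForm φ p d ↔ HasRiccati Ψ c d := by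
  constructor
  · rintro ⟨a, ha, h0, hY⟩
    refine (hasExpansion_of_hasSum ?_ d).hasRiccati hd h0 hY
    filter_upwards [ha, h] with w h1 h2
    rwa [← h2]
  · intro hR
    obtain ⟨a, ha⟩ := exists_hasSum hR.param_sq_mul_mem
    refine ⟨a, ?_, hR.of_hasExpansion hd (hasExpansion_of_hasSum ha d)⟩
    filter_upwards [ha, h] with w h1 h2
    rwa [h2]

theorem HasRiccati.leading {Ψ : RatFunc ℂ} {c : ℂ} {d : ℕ} (hd : 1 ≤ d) (h : HasRiccati Ψ c d) :
    ∃ s ∈ 𝓞 c, param c ^ 2 * Ψ = RatFunc.C ((1 - (d : ℂ) ^ 2) / 2) + param c * s := by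
  obtain ⟨a, ha⟩ := exists_hasExpansion h.param_sq_mul_mem d
  have h0 := (h.of_hasExpansion hd ha).1
  obtain ⟨s, hs, hΨ⟩ := ha
  rw [aeval_param_eq, coeff_sum_monomial _ _ (Nat.zero_le d), h0] at hΨ
  refine ⟨_, add_mem (aeval_param_mem c
    (∑ n ∈ Finset.range (d + 1), Polynomial.monomial n (a n)).divX) (mul_mem (pow_mem (param_mem_regularAt c c) d) hs), ?_⟩
  rw [hΨ]; ring

/-- The leading coefficient (1 - d²)/2 of t²Ψ determines the positive integer d. -/
theorem HasRiccati.unique {Ψ : RatFunc ℂ} {c : ℂ} {d e : ℕ} (hd : 1 ≤ d) (he : 1 ≤ e)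
    (h : HasRiccati Ψ c d) (h' : HasRiccati Ψ c e) : d = e := by
  obtain ⟨s, hs, h1⟩ := h.leading hd
  obtain ⟨r, hr, h2⟩ := h'.leading he
  by_contra hne
  refine C_add_ne_zero (c := c) (a := (1 - (d : ℂ) ^ 2) / 2 - (1 - (e : ℂ) ^ 2) / 2) (s := s - r)
    ?_ (sub_mem hs hr) ?_
  · intro h0
    have h3 : ((d : ℂ)) ^ 2 = (e : ℂ) ^ 2 := by linear_combination -2 * h0
    have h4 : d ^ 2 = e ^ 2 := by exact_mod_cast h3
    exact hne (Nat.pow_left_injective (n := 2) (by norm_num) h4)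
  · rw [map_sub]
    linear_combination h2 - h1

theorem HasRiccati.order_eq {Ψ : RatFunc ℂ} {c : ℂ} {d : ℕ} (hd : 2 ≤ d) (h : HasRiccati Ψ c d) :
    meromorphicOrderAt (fun w => toFun Ψ (c + w)) 0 = (-2 : ℤ) := by
  obtain ⟨s, hs, h1⟩ := h.leading (by omega)
  have ht := param_ne_zero c
  have ha : (1 - (d : ℂ) ^ 2) / 2 ≠ 0 := by
    intro h0
    have h3 : ((d : ℂ)) ^ 2 = 1 := by linear_combination -2 * h0
    have h4 : d ^ 2 = 1 := by exact_mod_cast h3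
    nlinarith
  rw [← meromorphicOrderAt_toFun (isUnitAt_C_add ha hs) (-2), ← h1]
  congr
  funext w
  congr 1
  rw [zpow_neg, ← mul_assoc]
  norm_cast
  rw [inv_mul_cancel₀ (pow_ne_zero 2 ht), one_mul]

theorem HasRiccati.regular {Ψ : RatFunc ℂ} {c : ℂ} (h : HasRiccati Ψ c 1) : Ψ ∈ 𝓞 c := by
  obtain ⟨g, hg, s, hs, hgs⟩ := h
  have hg' : g ∈ 𝓞 c := by simpa using hg
  have : Ψ = 2 * (s - 𝐃 g - g ^ 2) := by
    simp only [Nat.sub_self, pow_zero, one_mul] at hgs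
    linear_combination 2 * hgs
  rw [this]
  exact mul_mem (ofNat_mem _ 2) (sub_mem (sub_mem hs (ratDeriv_mem_regularAt hg')) (pow_mem hg' 2))

/-! ### Local degrees -/

theorem meromorphicLocalDegree_congr {f g : ℂ → ℂ} {x : ℂ} (h : f =ᶠ[𝓝[≠] x] g) :
    meromorphicLocalDegree f x = meromorphicLocalDegree g x := by
  have hl : limUnder (𝓝[≠] x) f = limUnder (𝓝[≠] x) g := by
    unfold limUnder; rw [map_congr h]
  have h2 : (fun z => f z - limUnder (𝓝[≠] x) f) =ᶠ[𝓝[≠] x] fun z => g z - limUnder (𝓝[≠] x) g := by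
    filter_upwards [h] with z hz
    rw [hz, hl]
  unfold meromorphicLocalDegree
  rw [meromorphicOrderAt_congr h, meromorphicOrderAt_congr h2]

/-- The Schwarzian derivative satisfies the Riccati condition for the local degree. -/
theorem hasRiccati_localDegree_aux {F : RatFunc ℂ} (hF : Nonconstant F) (c : ℂ) :
    1 ≤ meromorphicLocalDegree (fun w => toFun F (c + w)) 0 ∧
      HasRiccati (ratSchwarzian F) c (meromorphicLocalDegree (fun w => toFun F (c + w)) 0) := by
  have ht := param_ne_zero c
  by_cases hreg : F ∈ 𝓞 c
  · obtain ⟨a, s, hs, hFs⟩ := exists_value hreg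
    have hs0 : s ≠ 0 := by
      rintro rfl
      exact hF a (by simpa using hFs)
    obtain ⟨k, v, hv, rfl⟩ := exists_factor c hs0
    have hk := (zpow_mul_mem_iff hv k).1 hs
    lift k to ℕ using hk
    have hFv : F = RatFunc.C a + param c ^ (k + 1) * v := by
      rw [hFs, zpow_natCast]; ring
    have hlim : limUnder (𝓝[≠] 0) (fun w => toFun F (c + w)) = a := by
      apply Tendsto.limUnder_eq
      have h1 := (analyticAt_toFun_add hreg).continuousAt.tendsto
      have h2 : toFun F (c + 0) = a := by
        rw [add_zero, hFs, toFun_add (C_mem_regularAt c a) (mul_mem (param_mem_regularAt c c) hs),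
          toFun_mul (param_mem_regularAt c c) hs, toFun_C, toFun_param, sub_self, zero_mul, add_zero]
      rw [h2] at h1
      exact h1.mono_left nhdsWithin_le_nhds
    have hord : meromorphicOrderAt (fun w => toFun F (c + w) - a) 0 = ((k + 1 : ℕ) : ℤ) := by
      rw [← meromorphicOrderAt_toFun hv]
      apply meromorphicOrderAt_congr
      filter_upwards [eventually_nhdsNE_of_cofinite (eventually_regularAt v) c] with w hw
      have h3 := mul_mem (pow_mem (param_mem_regularAt (c + w) c) (k + 1)) hw
      rw [hFv, zpow_natCast, toFun_add (C_mem_regularAt _ a) h3, toFun_C, add_sub_cancel_left]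
    have hdeg : meromorphicLocalDegree (fun w => toFun F (c + w)) 0 = k + 1 := by
      rw [meromorphicLocalDegree, if_neg (not_lt.2 (regularAt_iff_order.1 hreg)), hlim, hord]
      rfl
    rw [hdeg, hFv, ratSchwarzian_C_add]
    exact ⟨by omega, hasRiccati_ratSchwarzian (by omega) hv⟩
  · have hF0 : F ≠ 0 := by rintro rfl; exact hreg (zero_mem _)
    obtain ⟨n, v, hv, hFv⟩ := exists_factor c hF0
    have hn : n < 0 := by
      rw [hFv, zpow_mul_mem_iff hv] at hreg; omega
    obtain ⟨k, rfl⟩ : ∃ k : ℕ, n = -(k : ℤ) := ⟨n.natAbs, by omega⟩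
    have hord : meromorphicOrderAt (fun w => toFun F (c + w)) 0 = (-(k : ℤ) : ℤ) := by
      rw [hFv, meromorphicOrderAt_toFun hv]
    have hdeg : meromorphicLocalDegree (fun w => toFun F (c + w)) 0 = k := by
      rw [meromorphicLocalDegree, hord, if_pos (by exact_mod_cast hn), WithTop.untop₀_coe]
      omega
    have hinv : F⁻¹ = param c ^ k * v⁻¹ := by
      rw [hFv, mul_inv, zpow_neg, inv_inv, zpow_natCast]
    rw [hdeg, ← ratSchwarzian_inv hF, hinv]
    exact ⟨by omega, hasRiccati_ratSchwarzian (by omega) hv.inv⟩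

/-! ### Charts of the sphere -/

/-- The position of `p` in its chart. -/
def chartPoint : OnePoint ℂ → ℂ
  | OnePoint.some c => c
  | OnePoint.infty => 0

/-- A rational map in the chart around `p`. -/
def chartMap (f : RatFunc ℂ) : OnePoint ℂ → RatFunc ℂ
  | OnePoint.some _ => f
  | OnePoint.infty => invert f

/-- A rational quadratic differential in the chart around `p`. -/
def chartQuadDiff (Φ : RatFunc ℂ) : OnePoint ℂ → RatFunc ℂ
  | OnePoint.some _ => Φ
  | OnePoint.infty => invert Φ * 𝐃 RatFunc.X⁻¹ ^ 2

theorem ratSchwarzian_X : ratSchwarzian RatFunc.X = 0 := by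
  simp [ratSchwarzian]

theorem ratSchwarzian_chartMap {f : RatFunc ℂ} (hf : Nonconstant f) (p : OnePoint ℂ) :
    ratSchwarzian (chartMap f p) = chartQuadDiff (ratSchwarzian f) p := by
  induction p using OnePoint.rec with
  | coe c => rfl
  | infty =>
    have h := ratSchwarzian_subst nonconstant_X_inv hf
    rwa [ratSchwarzian_inv nonconstant_X, ratSchwarzian_X, add_zero] at h

theorem nonconstant_chartMap {f : RatFunc ℂ} (hf : Nonconstant f) (p : OnePoint ℂ) :
    Nonconstant (chartMap f p) := by
  induction p using OnePoint.rec with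
  | coe c => exact hf
  | infty => exact nonconstant_X_inv.subst hf

theorem localDegree_eq (f : RatFunc ℂ) (p : OnePoint ℂ) :
    localDegree f p = meromorphicLocalDegree (fun w => toFun (chartMap f p) (chartPoint p + w)) 0 := by
  induction p using OnePoint.rec with
  | coe c => rfl
  | infty =>
    apply meromorphicLocalDegree_congr
    filter_upwards [(toFun_invert f).filter_mono (nhdsNE_le_cofinite 0)] with w hw
    change toFun f w⁻¹ = toFun (invert f) (0 + w)
    rw [zero_add, hw]

theorem hasRiccati_localDegree {f : RatFunc ℂ} (hf : Nonconstant f) (p : OnePoint ℂ) :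
    1 ≤ localDegree f p ∧
      HasRiccati (chartQuadDiff (ratSchwarzian f) p) (chartPoint p) (localDegree f p) := by
  rw [localDegree_eq, ← ratSchwarzian_chartMap hf]
  exact hasRiccati_localDegree_aux (nonconstant_chartMap hf p) _

theorem eventually_nhdsNE_of_codiscrete {P : ℂ → Prop} (h : ∀ᶠ z in codiscrete ℂ, P z) (c : ℂ) :
    ∀ᶠ z in 𝓝[≠] c, P z := by
  have := mem_codiscreteWithin_iff_forall_mem_nhdsNE.1 h c (Set.mem_univ c)
  rwa [Set.compl_univ, Set.union_empty] at this

theorem toFun_chartQuadDiff_infty (Φ : RatFunc ℂ) :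
    ∀ᶠ w in cofinite, toFun (chartQuadDiff Φ OnePoint.infty) w = toFun Φ w⁻¹ / w ^ 4 := by
  filter_upwards [toFun_invert Φ, eventually_regularAt (invert Φ),
    eventually_isUnitAt X_ne_zero] with w h1 h2 h3
  have : chartQuadDiff Φ OnePoint.infty = invert Φ * RatFunc.X⁻¹ ^ 4 := by
    have hX := X_ne_zero
    change invert Φ * 𝐃 RatFunc.X⁻¹ ^ 2 = _
    rw [ratDeriv_inv, ratDeriv_X]
    field_simp
  rw [this, toFun_mul h2 (pow_mem h3.2.2 4), toFun_pow h3.2.2, toFun_inv h3, toFun_X, h1, inv_pow,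
    div_eq_mul_inv]

/-- At ∞ the codiscrete hypothesis is not enough, as a closed discrete subset of ℂ may be unbounded.
Meromorphy at ∞ supplies a dichotomy: near ∞ the two functions agree everywhere or nowhere. -/
theorem localCoeff_eventuallyEq {φ : ℂ → ℂ} (hφ : IsMeromorphicQuadDiff φ) {Φ : RatFunc ℂ}
    (h : φ =ᶠ[codiscrete ℂ] toFun Φ) (p : OnePoint ℂ) :
    localCoeff φ p =ᶠ[𝓝[≠] 0] fun w => toFun (chartQuadDiff Φ p) (chartPoint p + w) := by
  induction p using OnePoint.rec with
  | coe c =>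
    have h1 : Tendsto (fun w : ℂ => c + w) (𝓝[≠] 0) (𝓝[≠] c) := by
      refine tendsto_nhdsWithin_of_tendsto_nhds_of_eventually_within _ ?_ ?_
      · have : Tendsto (fun w : ℂ => c + w) (𝓝 0) (𝓝 (c + 0)) :=
          (continuous_const.add continuous_id).tendsto 0
        rw [add_zero] at this
        exact this.mono_left nhdsWithin_le_nhds
      · filter_upwards [self_mem_nhdsWithin] with w hw
        simpa using hw
    exact h1.eventually (eventually_nhdsNE_of_codiscrete h c)
  | infty =>
    have hm := (hφ OnePoint.infty).sub
      (meromorphicAt_toFun (chartQuadDiff Φ OnePoint.infty) (chartPoint OnePoint.infty))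
    rcases hm.eventually_eq_zero_or_eventually_ne_zero with h0 | h0
    · filter_upwards [h0] with w hw
      exact sub_eq_zero.1 hw
    · exfalso
      have h1 : ∀ᶠ w in 𝓝[≠] (0 : ℂ), φ w⁻¹ ≠ toFun Φ w⁻¹ := by
        filter_upwards [h0, (toFun_chartQuadDiff_infty Φ).filter_mono (nhdsNE_le_cofinite 0)]
          with w hw hw2 heq
        apply hw
        change φ w⁻¹ / w ^ 4 - toFun (chartQuadDiff Φ OnePoint.infty) (0 + w) = 0
        rw [zero_add, hw2, heq, sub_self]
      have h2 : ∀ᶠ z in Bornology.cobounded ℂ, φ z ≠ toFun Φ z := by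
        have := tendsto_inv₀_cobounded'.eventually h1
        simpa using this
      -- Agreement holds on a punctured neighbourhood of the point |R| + 1 for every R, hence at
      -- arbitrarily large z, excluding the second alternative.
      have h3 : ∃ᶠ z in Bornology.cobounded ℂ, φ z = toFun Φ z := by
        rw [← comap_norm_atTop, frequently_comap, frequently_atTop]
        intro R
        have h4 := eventually_nhdsNE_of_codiscrete h ((|R| + 1 : ℝ) : ℂ)
        have h5 : ∀ᶠ z in 𝓝[≠] ((|R| + 1 : ℝ) : ℂ), R ≤ ‖z‖ := by
          apply Filter.Eventually.filter_mono nhdsWithin_le_nhds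
          refine ((continuous_norm.tendsto ((|R| + 1 : ℝ) : ℂ)).eventually_const_lt (u := R) ?_).mono
            fun _ => le_of_lt
          rw [Complex.norm_real, Real.norm_eq_abs]
          have := le_abs_self R
          have := abs_nonneg R
          rw [abs_of_nonneg (by linarith)]
          linarith
        obtain ⟨z, hz1, hz2⟩ := (h4.and h5).exists
        exact ⟨‖z‖, hz2, z, rfl, hz1⟩
      exact h3 h2

/-! ### The local theory at the points of the sphere -/

theorem isSchwarzianOf_iff {φ : ℂ → ℂ} {f : RatFunc ℂ} (hf : Nonconstant f) :
    IsSchwarzianOf φ f ↔ φ =ᶠ[codiscrete ℂ] toFun (ratSchwarzian f) := by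
  have h : schwarzian (toFun f) =ᶠ[codiscrete ℂ] toFun (ratSchwarzian f) :=
    (toFun_ratSchwarzian hf).filter_mono codiscrete_le_cofinite
  exact ⟨fun h1 => h1.trans h, fun h1 => h1.trans h.symm⟩

theorem orderAt_eq {φ : ℂ → ℂ} {p : OnePoint ℂ} {Ψ : RatFunc ℂ} {c : ℂ}
    (h : localCoeff φ p =ᶠ[𝓝[≠] 0] fun w => toFun Ψ (c + w)) :
    orderAt φ p = meromorphicOrderAt (fun w => toFun Ψ (c + w)) 0 :=
  meromorphicOrderAt_congr h

theorem not_isPole_iff {φ : ℂ → ℂ} {p : OnePoint ℂ} {Ψ : RatFunc ℂ} {c : ℂ}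
    (h : localCoeff φ p =ᶠ[𝓝[≠] 0] fun w => toFun Ψ (c + w)) : ¬ IsPole φ p ↔ Ψ ∈ 𝓞 c := by
  rw [IsPole, orderAt_eq h, not_lt, regularAt_iff_order]

/-- The quadratic differential of a rational map at a point of the sphere. -/
theorem schwarzian_local {φ : ℂ → ℂ} (hφ : IsMeromorphicQuadDiff φ) {f : RatFunc ℂ}
    (hf : Nonconstant f) (h : IsSchwarzianOf φ f) (p : OnePoint ℂ) :
    HasLocalForm φ p (localDegree f p) ∧ (IsPole φ p → orderAt φ p = ((-2 : ℤ) : WithTop ℤ)) ∧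
      (IsCriticalPoint f p ↔ IsPole φ p) := by
  have hloc := localCoeff_eventuallyEq hφ ((isSchwarzianOf_iff hf).1 h) p
  obtain ⟨hd, hR⟩ := hasRiccati_localDegree hf p
  refine ⟨(hasLocalForm_iff hd hloc).2 hR, ?_⟩
  by_cases hd2 : 2 ≤ localDegree f p
  · have ho : orderAt φ p = ((-2 : ℤ) : WithTop ℤ) := (orderAt_eq hloc).trans (hR.order_eq hd2)
    refine ⟨fun _ => ho, fun _ => ?_, fun _ => hd2⟩
    rw [IsPole, ho]
    exact_mod_cast (by norm_num : (-2 : ℤ) < 0)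
  · have h1 : localDegree f p = 1 := by omega
    rw [h1] at hR
    have hnp : ¬ IsPole φ p := (not_isPole_iff hloc).2 hR.regular
    exact ⟨fun hp => absurd hp hnp, fun hc => absurd hc hd2, fun hp => absurd hp hnp⟩

theorem param_sq_mul_mem_of_order {Ψ : RatFunc ℂ} {c : ℂ}
    (h : ((-2 : ℤ) : WithTop ℤ) ≤ meromorphicOrderAt (fun w => toFun Ψ (c + w)) 0) :
    param c ^ 2 * Ψ ∈ 𝓞 c := by
  by_cases h0 : Ψ = 0
  · rw [h0, mul_zero]; exact zero_mem _
  · obtain ⟨n, v, hv, rfl⟩ := exists_factor c h0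
    rw [meromorphicOrderAt_toFun hv] at h
    have hn : -2 ≤ n := by exact_mod_cast h
    rw [← mul_assoc, ← zpow_natCast, ← zpow_add₀ (param_ne_zero c), zpow_mul_mem_iff hv]
    push_cast
    omega

/-! ### Möbius changes of coordinate -/

theorem subst_congr {m n : RatFunc ℂ} (hm : Nonconstant m) (hn : Nonconstant n) (h : m = n)
    (u : RatFunc ℂ) : subst m hm u = subst n hn u := by
  subst h; rfl

/-- A rational quadratic differential with at most a double pole at `e`, and satisfying the local
conditions elsewhere, is the Schwarzian derivative of a rational map. -/
theorem exists_ratSchwarzian_eq_sphere {Φ : RatFunc ℂ} {d : OnePoint ℂ → ℕ} (e : OnePoint ℂ)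
    (hd : ∀ p, 1 ≤ d p) (hfin : {p | d p ≠ 1}.Finite)
    (hR : ∀ p, p ≠ e → HasRiccati (chartQuadDiff Φ p) (chartPoint p) (d p))
    (he : param (chartPoint e) ^ 2 * chartQuadDiff Φ e ∈ 𝓞 (chartPoint e)) :
    ∃ f, Nonconstant f ∧ ratSchwarzian f = Φ := by
  have hX := X_ne_zero
  have hDX : 𝐃 (RatFunc.X : RatFunc ℂ)⁻¹ = -(RatFunc.X⁻¹) ^ 2 := by
    rw [ratDeriv_inv, ratDeriv_X]; field_simp
  induction e using OnePoint.rec with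
  | infty =>
    refine exists_ratSchwarzian_eq (d := fun c : ℂ => d c) (fun c => hd c) ?_
      (fun c => hR c (OnePoint.coe_ne_infty c)) ?_
    · exact hfin.preimage (OnePoint.coe_injective.injOn)
    · change param 0 ^ 2 * (invert Φ * 𝐃 RatFunc.X⁻¹ ^ 2) ∈ 𝓞 0 at he
      have : RatFunc.X ^ (-2 : ℤ) * invert Φ = param 0 ^ 2 * (invert Φ * 𝐃 RatFunc.X⁻¹ ^ 2) := by
        rw [hDX, param_zero, zpow_neg]
        field_simp
      rwa [DegLE, this]
  | coe e =>
    change param e ^ 2 * Φ ∈ 𝓞 e at he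
    -- This Möbius map sends ∞ to e; `q` below is its action on the finite points, which misses e.
    set m : RatFunc ℂ := RatFunc.C e + RatFunc.X⁻¹ with hm
    have hDm : 𝐃 m = -(RatFunc.X⁻¹) ^ 2 := by rw [hm, map_add, ratDeriv_C, zero_add, hDX]
    have hmn : Nonconstant m := nonconstant_of_ratDeriv_ne_zero (by
      rw [hDm]; exact neg_ne_zero.2 (pow_ne_zero 2 (inv_ne_zero hX)))
    have hSm : ratSchwarzian m = 0 := by
      rw [hm, ratSchwarzian_C_add, ratSchwarzian_inv nonconstant_X, ratSchwarzian_X]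
    have hm0 : m ≠ 0 := by
      intro h; rw [h, map_zero] at hDm; exact neg_ne_zero.2 (pow_ne_zero 2 (inv_ne_zero hX)) hDm.symm
    set Ψ := subst m hmn Φ * 𝐃 m ^ 2 with hΨ
    let q : ℂ → OnePoint ℂ := fun c => if c = 0 then OnePoint.infty else ((e + c⁻¹ : ℂ) : OnePoint ℂ)
    have hq : Function.Injective q := by
      intro a b hab
      simp only [q] at hab
      split_ifs at hab with h1 h2 h2
      · rw [h1, h2]
      · exact absurd hab.symm (OnePoint.coe_ne_infty _)
      · exact absurd hab (OnePoint.coe_ne_infty _)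
      · simpa using hab
    have hqe : ∀ c, q c ≠ e := by
      intro c hc
      simp only [q] at hc
      split_ifs at hc with h1
      · exact absurd hc.symm (OnePoint.coe_ne_infty _)
      · have := OnePoint.coe_injective hc
        simp [h1] at this
    have hRic : ∀ c, HasRiccati Ψ c (d (q c)) := by
      intro c
      have h := hR (q c) (hqe c)
      by_cases hc : c = 0
      · subst hc
        have hq0 : q 0 = OnePoint.infty := if_pos rfl
        rw [hq0] at h ⊢
        change HasRiccati (invert Φ * 𝐃 RatFunc.X⁻¹ ^ 2) 0 _ at h
        -- The point 0 goes to ∞, where the chart is 1/z, so the change of coordinate is m⁻¹ = X /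
        -- (1 + eX).
        have hn : Nonconstant m⁻¹ := nonconstant_of_ratDeriv_ne_zero (by
          rw [ratDeriv_inv]
          exact div_ne_zero (neg_ne_zero.2 hmn.ratDeriv_ne_zero) (pow_ne_zero 2 hm0))
        have hV := (isUnitAt_C_add (c := 0) one_ne_zero (C_mem_regularAt 0 e)).inv
        have hmV : m⁻¹ = RatFunc.C 0 + param 0 * (RatFunc.C 1 + param 0 * RatFunc.C e)⁻¹ := by
          have hV0 := (C_add_ne_zero (c := 0) one_ne_zero (C_mem_regularAt 0 e))
          rw [map_zero, zero_add]
          rw [hm] at hm0 ⊢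
          rw [param_zero, map_one] at *
          field_simp
          ring
        have h2 := h.subst hn hV hmV (by rw [ratSchwarzian_inv hmn, hSm])
        convert h2 using 1
        have hsX : subst m⁻¹ hn RatFunc.X⁻¹ = m := by rw [map_inv₀, subst_X, inv_inv]
        have hch := ratDeriv_subst hn (RatFunc.X⁻¹)
        rw [hsX] at hch
        have hs : subst m⁻¹ hn (invert Φ) = subst m hmn Φ := by
          rw [invert, subst_subst hn nonconstant_X_inv (by rw [hsX]; exact hmn)]
          exact subst_congr _ _ hsX Φ
        rw [hΨ, map_mul, map_pow, hs, hch]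
        ring
      · have hqc : q c = ((e + c⁻¹ : ℂ) : OnePoint ℂ) := if_neg hc
        rw [hqc] at h ⊢
        change HasRiccati Φ (e + c⁻¹) _ at h
        have hC : IsUnitAt c (RatFunc.C (-c⁻¹)) := by
          have := isUnitAt_C_add (c := c) (a := -c⁻¹) (by simpa using hc) (zero_mem (𝓞 c))
          simpa using this
        have hXu : IsUnitAt c (RatFunc.X : RatFunc ℂ) := by
          rw [← param_zero]; exact isUnitAt_param hc
        refine h.subst hmn (hC.mul hXu.inv) ?_ hSm
        have hc' : RatFunc.C c ≠ 0 := by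
          rwa [Ne, map_eq_zero]
        rw [hm, param, map_neg, map_add, map_inv₀]
        field_simp
        ring
    -- The inverse of m, used to carry the solution back.
    have hk : Nonconstant (param e)⁻¹ := nonconstant_of_ratDeriv_ne_zero (by
      rw [ratDeriv_inv, ratDeriv_param]
      exact div_ne_zero (neg_ne_zero.2 one_ne_zero) (pow_ne_zero 2 (param_ne_zero e)))
    have hSk : ratSchwarzian (param e)⁻¹ = 0 := by
      rw [ratSchwarzian_inv (nonconstant_of_ratDeriv_ne_zero (by simp)), param, sub_eq_add_neg,
        add_comm, ← map_neg, ratSchwarzian_C_add, ratSchwarzian_X]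
    obtain ⟨F, hF, hSF⟩ := exists_ratSchwarzian_eq (d := fun c => d (q c)) (fun c => hd _)
      (hfin.preimage hq.injOn) hRic (by
        -- Inverting X turns m into e + X, so the growth bound at infinity is the bound on the pole
        -- at e.
        have hn : Nonconstant (RatFunc.C e + param 0 * 1) := nonconstant_of_ratDeriv_ne_zero (by
          simp)
        have h1 := subst_mem_regularAt (c := 0) hn (one_mem _) rfl he
        have hs : invert (subst m hmn Φ) = subst _ hn Φ := by
          have hsX : subst RatFunc.X⁻¹ nonconstant_X_inv m = RatFunc.C e + param 0 * 1 := by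
            rw [hm, map_add, subst_C, map_inv₀, subst_X, inv_inv, param_zero, mul_one]
          rw [invert, subst_subst nonconstant_X_inv hmn (by rw [hsX]; exact hn)]
          exact subst_congr _ _ hsX Φ
        have hpe : subst _ hn (param e) = RatFunc.X := by
          have hpa : param e = RatFunc.X - RatFunc.C e := rfl
          rw [hpa, map_sub, subst_X, subst_C, param_zero, mul_one, add_sub_cancel_left]
        have h2 : RatFunc.X ^ (-2 : ℤ) * invert Ψ
            = subst _ hn (param e ^ 2 * Φ) := by
          rw [hΨ, map_mul, hs, map_pow, hDm, map_neg, map_pow, map_inv₀, invert_X, inv_inv,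
            map_mul, map_pow, hpe, zpow_neg]
          norm_cast
          field_simp
        rwa [DegLE, h2])
    refine ⟨subst _ hk F, hk.subst hF, ?_⟩
    have hkm : subst _ hk m = RatFunc.X := by
      rw [hm, map_add, subst_C, map_inv₀, subst_X, inv_inv, param]; ring
    have hch := ratDeriv_subst hk m
    rw [hkm, ratDeriv_X] at hch
    have hs : subst _ hk (subst m hmn Φ) = Φ := by
      rw [subst_subst hk hmn (by rw [hkm]; exact nonconstant_X)]
      rw [subst_congr _ nonconstant_X hkm, subst_self]
    rw [ratSchwarzian_subst hk hF, hSF, hSk, add_zero, hΨ, map_mul, hs, map_pow]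
    linear_combination (-Φ * (subst _ hk (𝐃 m) * 𝐃 (param e)⁻¹ + 1)) * hch

/-! ### Meromorphic quadratic differentials on the sphere are rational -/

theorem eventually_cobounded_ne_zero : ∀ᶠ z in Bornology.cobounded ℂ, z ≠ 0 := by
  filter_upwards [eventually_cobounded_le_norm (1 : ℝ)] with z hz h0
  rw [h0, norm_zero] at hz
  exact absurd hz (by norm_num)

theorem isBigO_pow_cobounded {m n : ℕ} (h : m ≤ n) :
    (fun z : ℂ => z ^ m) =O[Bornology.cobounded ℂ] fun z => z ^ n := by
  refine Asymptotics.IsBigO.of_bound 1 ?_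
  filter_upwards [eventually_cobounded_le_norm (1 : ℝ)] with z hz
  rw [norm_pow, norm_pow, one_mul]
  exact pow_le_pow_right₀ hz h

theorem exists_isBigO_polynomial (P : Polynomial ℂ) :
    ∃ k : ℕ, (fun z => P.eval z) =O[Bornology.cobounded ℂ] fun z => z ^ k := by
  induction P using Polynomial.induction_on' with
  | add p q hp hq =>
    obtain ⟨k, hk⟩ := hp
    obtain ⟨l, hl⟩ := hq
    refine ⟨max k l, ?_⟩
    simp only [Polynomial.eval_add]
    exact (hk.trans (isBigO_pow_cobounded (le_max_left k l))).add
      (hl.trans (isBigO_pow_cobounded (le_max_right k l)))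
  | monomial n a =>
    refine ⟨n, ?_⟩
    simp only [Polynomial.eval_monomial]
    exact (Asymptotics.isBigO_refl _ _).const_mul_left a

/-- An entire function of polynomial growth is a polynomial. -/
theorem exists_polynomial_of_isBigO {E : ℂ → ℂ} (hE : Differentiable ℂ E) (n : ℕ)
    (h : E =O[Bornology.cobounded ℂ] fun z => z ^ n) : ∃ P : Polynomial ℂ, ∀ z, E z = P.eval z := by
  induction n generalizing E with
  | zero =>
    simp only [pow_zero] at h
    obtain ⟨C, hC⟩ := h.bound
    rw [← comap_norm_atTop, eventually_comap] at hC
    obtain ⟨R, hR⟩ := eventually_atTop.1 hC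
    obtain ⟨B, hB⟩ := (isCompact_closedBall (0 : ℂ) R).exists_bound_of_continuousOn
      hE.continuous.continuousOn
    have hb : Bornology.IsBounded (Set.range E) := by
      rw [isBounded_iff_forall_norm_le]
      refine ⟨max C B, ?_⟩
      rintro _ ⟨z, rfl⟩
      rcases le_total R ‖z‖ with hz | hz
      · exact (by simpa using hR _ hz z rfl : ‖E z‖ ≤ C).trans (le_max_left _ _)
      · exact (hB z (by simpa using hz)).trans (le_max_right _ _)
    obtain ⟨c, hc⟩ := hE.exists_const_forall_eq_of_bounded hb
    exact ⟨Polynomial.C c, fun z => by rw [hc z, Polynomial.eval_C]⟩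
  | succ n ih =>
    -- The difference quotient at 0 is entire and its growth bound is one degree lower.
    have hd : Differentiable ℂ (dslope E 0) := by
      rw [← differentiableOn_univ, Complex.differentiableOn_dslope univ_mem]
      exact hE.differentiableOn
    have hne : ∀ᶠ z in Bornology.cobounded ℂ, z ≠ (0 : ℂ) := eventually_cobounded_ne_zero
    have hg : dslope E 0 =O[Bornology.cobounded ℂ] fun z => z ^ n := by
      have hconst : (fun _ : ℂ => E 0) =O[Bornology.cobounded ℂ] fun z : ℂ => z ^ (n + 1) := by
        have h1 : (fun _ : ℂ => E 0) =O[Bornology.cobounded ℂ] fun z : ℂ => z ^ 0 := by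
          simp only [pow_zero]; exact Asymptotics.isBigO_const_const _ one_ne_zero _
        exact h1.trans (isBigO_pow_cobounded (Nat.zero_le _))
      have h2 := (h.sub hconst).mul
        (Asymptotics.isBigO_refl (fun z : ℂ => z⁻¹) (Bornology.cobounded ℂ))
      refine h2.congr' ?_ ?_
      · filter_upwards [hne] with z hz
        rw [dslope_of_ne _ hz, slope_def_field, sub_zero, div_eq_mul_inv]
      · filter_upwards [hne] with z hz
        rw [pow_succ, mul_inv_cancel_right₀ hz]
    obtain ⟨P, hP⟩ := ih hd hg
    refine ⟨Polynomial.C (E 0) + Polynomial.X * P, fun z => ?_⟩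
    have h3 := sub_smul_dslope E 0 z
    rw [sub_zero, smul_eq_mul, hP] at h3
    rw [Polynomial.eval_add, Polynomial.eval_mul, Polynomial.eval_C, Polynomial.eval_X, h3]
    ring

theorem IsMeromorphicQuadDiff.meromorphicAt {φ : ℂ → ℂ} (hφ : IsMeromorphicQuadDiff φ) (c : ℂ) :
    MeromorphicAt φ c := by
  have h := hφ c
  have h2 : MeromorphicAt (fun z => localCoeff φ c (z - c)) c :=
    MeromorphicAt.comp_analyticAt (g := fun z => z - c) (by rw [sub_self]; exact h) (by fun_prop)
  have h3 : (fun z => localCoeff φ c (z - c)) = φ := by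
    funext z
    change φ (c + (z - c)) = φ z
    rw [add_sub_cancel]
  rwa [h3] at h2

/-- In w = 1/z a meromorphic germ is analytic off w = 0, so poles cannot accumulate at ∞. -/
theorem IsMeromorphicQuadDiff.eventually_analyticAt {φ : ℂ → ℂ} (hφ : IsMeromorphicQuadDiff φ) :
    ∀ᶠ z in Bornology.cobounded ℂ, AnalyticAt ℂ φ z := by
  have h := tendsto_inv₀_cobounded'.eventually (hφ OnePoint.infty).eventually_analyticAt
  filter_upwards [h, eventually_cobounded_ne_zero] with z hz hz0
  have h1 : AnalyticAt ℂ (fun x => localCoeff φ OnePoint.infty x⁻¹ * (x⁻¹) ^ 4) z :=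
    (hz.comp (analyticAt_inv hz0)).mul ((analyticAt_inv hz0).pow 4)
  refine h1.congr ?_
  filter_upwards [eventually_ne_nhds hz0] with x hx
  change φ x⁻¹⁻¹ / x⁻¹ ^ 4 * x⁻¹ ^ 4 = φ x
  rw [inv_inv]
  field_simp

theorem IsMeromorphicQuadDiff.exists_isBigO {φ : ℂ → ℂ} (hφ : IsMeromorphicQuadDiff φ) :
    ∃ n : ℕ, φ =O[Bornology.cobounded ℂ] fun z => z ^ n := by
  obtain ⟨n, hn⟩ := hφ OnePoint.infty
  refine ⟨n, ?_⟩
  have h1 : Tendsto (fun z : ℂ => (z⁻¹ - 0) ^ n • localCoeff φ OnePoint.infty z⁻¹)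
      (Bornology.cobounded ℂ) (𝓝 _) :=
    (hn.continuousAt.tendsto.mono_left (nhdsWithin_le_nhds (s := {0}ᶜ))).comp tendsto_inv₀_cobounded'
  have h2 : Tendsto (fun z : ℂ => z⁻¹ ^ 4) (Bornology.cobounded ℂ) (𝓝 (0 ^ 4)) :=
    tendsto_inv₀_cobounded.pow 4
  have h3 := ((h1.mul h2).isBigO_one ℂ).mul
    (Asymptotics.isBigO_refl (fun z : ℂ => z ^ n) (Bornology.cobounded ℂ))
  refine h3.congr' ?_ ?_
  · filter_upwards [eventually_cobounded_ne_zero] with z hz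
    change (z⁻¹ - 0) ^ n • (φ z⁻¹⁻¹ / z⁻¹ ^ 4) * z⁻¹ ^ 4 * z ^ n = φ z
    have hzn := pow_ne_zero n hz
    rw [inv_inv, sub_zero, smul_eq_mul, inv_pow]
    field_simp
  · exact Eventually.of_forall fun z => one_mul _

/-- A meromorphic quadratic differential on the sphere is given by a rational function. -/
theorem IsMeromorphicQuadDiff.exists_ratFunc {φ : ℂ → ℂ} (hφ : IsMeromorphicQuadDiff φ) :
    ∃ Φ : RatFunc ℂ, φ =ᶠ[codiscrete ℂ] toFun Φ := by
  classical
  have hfin : {z | ¬ AnalyticAt ℂ φ z}.Finite := by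
    have h1 := hφ.eventually_analyticAt
    rw [← comap_norm_atTop, eventually_comap] at h1
    obtain ⟨R, hR⟩ := eventually_atTop.1 h1
    have h2 : {z | AnalyticAt ℂ φ z} ∈ codiscreteWithin (Metric.closedBall (0 : ℂ) R) :=
      MeromorphicOn.analyticAt_mem_codiscreteWithin fun z _ => hφ.meromorphicAt z
    have h3 := (isCompact_closedBall (0 : ℂ) R).cofinite_inf_le_codiscreteWithin h2
    rw [mem_inf_principal, mem_cofinite] at h3
    refine h3.subset fun z hz => ?_
    have hz : ¬ AnalyticAt ℂ φ z := hz
    have hzR : z ∈ Metric.closedBall (0 : ℂ) R := by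
      rw [mem_closedBall_zero_iff]
      by_contra hlt
      exact hz (hR ‖z‖ (not_le.1 hlt).le z rfl)
    exact fun hcon => hz (hcon hzR)
  -- Multiplication by (z - c)^(k c) makes φ analytic at c, its value there included; only the
  -- finitely many non-analytic points enter q.
  choose k hk using fun c => hφ.meromorphicAt c
  set q : Polynomial ℂ := ∏ c ∈ hfin.toFinset, (Polynomial.X - Polynomial.C c) ^ k c with hq
  have hq0 : q ≠ 0 :=
    Finset.prod_ne_zero_iff.2 fun c _ => pow_ne_zero _ (Polynomial.X_sub_C_ne_zero c)
  have hpoly : ∀ (p : Polynomial ℂ) (z : ℂ), AnalyticAt ℂ (fun x => p.eval x) z := fun p z =>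
    p.differentiable.analyticAt z
  have hE : Differentiable ℂ fun z => q.eval z * φ z := by
    intro z
    by_cases hz : AnalyticAt ℂ φ z
    · exact ((hpoly q z).mul hz).differentiableAt
    · have hmem : z ∈ hfin.toFinset := by simpa using hz
      have h1 : (fun x => q.eval x * φ x) = fun x =>
          (∏ c ∈ hfin.toFinset.erase z, (Polynomial.X - Polynomial.C c) ^ k c).eval x
            * ((x - z) ^ k z • φ x) := by
        funext x
        rw [hq, ← Finset.mul_prod_erase _ _ hmem, Polynomial.eval_mul, Polynomial.eval_pow,
          Polynomial.eval_sub, Polynomial.eval_X, Polynomial.eval_C, smul_eq_mul]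
        ring
      rw [h1]
      exact ((hpoly _ z).mul (hk z)).differentiableAt
  obtain ⟨n, hn⟩ := hφ.exists_isBigO
  obtain ⟨l, hl⟩ := exists_isBigO_polynomial q
  obtain ⟨P, hP⟩ := exists_polynomial_of_isBigO hE (l + n) (by
    simp only [pow_add]; exact hl.mul hn)
  refine ⟨ι P / ι q, ?_⟩
  have hroots : ∀ᶠ z in cofinite, q.eval z ≠ 0 := by
    have h := Polynomial.finite_setOfPred_isRoot hq0
    filter_upwards [h.compl_mem_cofinite] with z hz h0
    exact hz h0
  refine Filter.Eventually.filter_mono codiscrete_le_cofinite ?_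
  filter_upwards [hroots] with z hz
  rw [toFun_div hz, ← hP z]
  field_simp

end SchwarzianSphere

end

/-! ### The theorem, from the local equivalence and the global construction. -/

open SchwarzianSphere in
theorem theorem1p1 (φ : ℂ → ℂ) (hφ : IsMeromorphicQuadDiff φ) :
    (∀ f : RatFunc ℂ, Nonconstant f → IsSchwarzianOf φ f →
      (∀ p : OnePoint ℂ, IsPole φ p → orderAt φ p = ((-2 : ℤ) : WithTop ℤ)) ∧
      (∀ p : OnePoint ℂ, IsCriticalPoint f p → HasLocalForm φ p (localDegree f p))) ∧
    (∀ (e : OnePoint ℂ) (d : OnePoint ℂ → ℕ),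
      (∀ p : OnePoint ℂ, IsPole φ p → p ≠ e → 2 ≤ d p ∧ HasLocalForm φ p (d p)) →
      (IsPole φ e → orderAt φ e = ((-2 : ℤ) : WithTop ℤ)) →
      ∃ f : RatFunc ℂ, Nonconstant f ∧ IsSchwarzianOf φ f ∧
        (∀ p : OnePoint ℂ, IsCriticalPoint f p ↔ IsPole φ p) ∧
        (∀ p : OnePoint ℂ, IsPole φ p → HasLocalForm φ p (localDegree f p)) ∧
        (∀ p : OnePoint ℂ, IsPole φ p → p ≠ e → localDegree f p = d p)) := by
  classical
  refine ⟨fun f hf hS => ⟨fun p => (schwarzian_local hφ hf hS p).2.1,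
    fun p _ => (schwarzian_local hφ hf hS p).1⟩, fun e d hd he => ?_⟩
  obtain ⟨Φ, hΦ⟩ := hφ.exists_ratFunc
  have hloc := localCoeff_eventuallyEq hφ hΦ
  set δ : OnePoint ℂ → ℕ := fun p => if IsPole φ p ∧ p ≠ e then d p else 1 with hδ
  have hδ1 : ∀ p, 1 ≤ δ p := by
    intro p
    simp only [hδ]
    split_ifs with h
    · have := (hd p h.1 h.2).1; omega
    · exact le_rfl
  have hfin : {p | δ p ≠ 1}.Finite := by
    have hc := eventually_regularAt Φ
    rw [eventually_cofinite] at hc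
    refine ((hc.image (fun c : ℂ => (c : OnePoint ℂ))).insert OnePoint.infty).subset ?_
    intro p hp
    have hpole : IsPole φ p := by
      by_contra hnp
      exact hp (by simp [hδ, hnp])
    induction p using OnePoint.rec with
    | infty => exact Set.mem_insert _ _
    | coe c =>
      refine Set.mem_insert_of_mem _ ⟨c, fun hreg => ?_, rfl⟩
      exact (not_isPole_iff (hloc c)).2 hreg hpole
  have hR : ∀ p, p ≠ e → HasRiccati (chartQuadDiff Φ p) (chartPoint p) (δ p) := by
    intro p hpe
    by_cases hp : IsPole φ p
    · have : δ p = d p := if_pos ⟨hp, hpe⟩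
      rw [this]
      obtain ⟨h2, hform⟩ := hd p hp hpe
      exact (hasLocalForm_iff (by omega) (hloc p)).1 hform
    · have : δ p = 1 := if_neg fun h => hp h.1
      rw [this]
      exact hasRiccati_one ((not_isPole_iff (hloc p)).1 hp)
  have hord : ((-2 : ℤ) : WithTop ℤ) ≤ orderAt φ e := by
    by_cases hp : IsPole φ e
    · exact (he hp).ge
    · exact le_trans (by exact_mod_cast (by norm_num : (-2 : ℤ) ≤ 0)) (not_lt.1 hp)
  rw [orderAt_eq (hloc e)] at hord
  obtain ⟨f, hf, hSf⟩ :=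
    exists_ratSchwarzian_eq_sphere e hδ1 hfin hR (param_sq_mul_mem_of_order hord)
  have hS : IsSchwarzianOf φ f := by
    rw [isSchwarzianOf_iff hf, hSf]; exact hΦ
  refine ⟨f, hf, hS, fun p => (schwarzian_local hφ hf hS p).2.2,
    fun p _ => (schwarzian_local hφ hf hS p).1, fun p hp hpe => ?_⟩
  obtain ⟨h1, h2⟩ := hasRiccati_localDegree hf p
  rw [hSf] at h2
  obtain ⟨h3, hform⟩ := hd p hp hpe
  -- The local degree of f and the given d p satisfy the Riccati condition for the same differential
  -- at p.
  exact h2.unique h1 (by omega) ((hasLocalForm_iff (by omega) (hloc p)).1 hform)
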